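/- Let $\mathbb{k}$ be an algebraically closed field of characteristic zero and let $m,n\ge 0$ be integers. Put $W=S_m\times S_n$, acting by permuting $x_1,\dots,x_m$ and $y_1,\dots,y_n$ separately. Case S: let $X=\mathbb{k}^{m|n}=\mathbb{k}^m\times\mathbb{k}^n$ and let $\mathcal{A}$ be the $\mathbb{k}$-algebra of supersymmetric polynomials, that is, of the $W$-invariant $f\in\mathbb{k}[x_1,\dots,x_m,y_1,\dots,y_n]$ such that for all $i,j$ the polynomial $f(x_i=t,\,y_j=-t)$ obtained by substitution does not depend on $t\in\mathbb{k}$. Case L: let $X=(\mathbb{k}^*)^{m|n}=(\mathbb{k}^*)^m\times(\mathbb{k}^*)^n$ and let $\mathcal{A}$ be the $\mathbb{k}$-algebra of Laurent supersymmetric polynomials, that is, of the $W$-invariant $f\in\mathbb{k}[x_1^{\pm1},\dots,x_m^{\pm1},y_1^{\pm1},\dots,y_n^{\pm1}]$ such that for all $i,j$ the Laurent polynomial $x_i\frac{\partial f}{\partial x_i}+y_j\frac{\partial f}{\partial y_j}$ lies in the ideal generated by $x_i-y_j$. For a subset $E\subseteq\mathcal{A}$ put $\mathcal{V}(E)=\{p\in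 X: f(p)=0 \text{ for all } f\in E\}$, and for a subset $V\subseteq X$ put $\mathcal{I}_{\mathcal{A}}(V)=\{f\in\mathcal{A}: f(p)=0\text{ for all }p\in V\}$. A superalgebraic set is a subset of $X$ of the form $\mathcal{V}(E)$ with $E\subseteq\mathcal{A}$; a radical ideal is an ideal that equals its radical (the unit ideal is included). Then in each of the cases S and L the maps $\mathcal{I}_{\mathcal{A}}$ and $\mathcal{V}$ are inverse bijections between the set of superalgebraic sets in $X$ and the set of radical ideals of $\mathcal{A}$, and both maps reverse inclusions. Moreover, if $m,n\ge 1$, then $\mathcal{A}$ is not Noetherian. -/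

import Mathlib

noncomputable section

namespace Supersym

/-! ### Supersymmetric polynomials

The variables are indexed by `Fin m ⊕ Fin n`: the variable `x_i` is `Sum.inl i` and the variable
`y_j` is `Sum.inr j`. -/

/-- The substitution `f ↦ f(x_i = t, y_j = -t)`; the other variables are left alone. -/
def substPoly (k : Type*) [Field k] (m n : ℕ) (i : Fin m) (j : Fin n) (t : k) :
    MvPolynomial (Fin m ⊕ Fin n) k →ₐ[k] MvPolynomial (Fin m ⊕ Fin n) k :=
  MvPolynomial.aeval
    (Function.update (Function.update MvPolynomial.X (Sum.inl i) (MvPolynomial.C t))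
      (Sum.inr j) (MvPolynomial.C (-t)))

/-- The `k`-algebra of supersymmetric polynomials in `x_1, …, x_m | y_1, …, y_n`: the polynomials
that are invariant under `S_m × S_n` and for which `f(x_i = t, y_j = -t)` does not depend on `t`.
(Because of the invariance it is the same to require the last condition for `i = j = 1` only, or
for all `i` and `j`.) -/
def superPoly (k : Type*) [Field k] (m n : ℕ) :
    Subalgebra k (MvPolynomial (Fin m ⊕ Fin n) k) where
  carrier := {f |
    (∀ (σ : Equiv.Perm (Fin m)) (τ : Equiv.Perm (Fin n)),
      MvPolynomial.rename (Equiv.sumCongr σ τ) f = f) ∧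
    (∀ (i : Fin m) (j : Fin n) (s t : k), substPoly k m n i j s f = substPoly k m n i j t f)}
  mul_mem' := by
    rintro f g ⟨hf, hf'⟩ ⟨hg, hg'⟩
    refine ⟨fun σ τ => ?_, fun i j s t => ?_⟩
    · rw [map_mul, hf, hg]
    · rw [map_mul, map_mul, hf' i j s t, hg' i j s t]
  add_mem' := by
    rintro f g ⟨hf, hf'⟩ ⟨hg, hg'⟩
    refine ⟨fun σ τ => ?_, fun i j s t => ?_⟩
    · rw [map_add, hf, hg]
    · rw [map_add, map_add, hf' i j s t, hg' i j s t]
  algebraMap_mem' := by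
    intro r
    refine ⟨fun σ τ => ?_, fun i j s t => ?_⟩
    · rw [AlgHom.commutes]
    · rw [AlgHom.commutes, AlgHom.commutes]

/-- Evaluation of a supersymmetric polynomial at a point of `k^{m|n} = k^m × k^n`. -/
def evalPoly (k : Type*) [Field k] (m n : ℕ) (p : Fin m ⊕ Fin n → k) : superPoly k m n →ₐ[k] k :=
  (MvPolynomial.aeval p).comp (superPoly k m n).val

/-! ### Laurent supersymmetric polynomials -/

/-- The ring of Laurent polynomials `k[x_1^{±1}, …, x_m^{±1}, y_1^{±1}, …, y_n^{±1}]`. -/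
abbrev Laurent (k : Type*) [Field k] (m n : ℕ) : Type _ :=
  AddMonoidAlgebra k ((Fin m ⊕ Fin n) →₀ ℤ)

/-- The variable `x_i` (for `v = Sum.inl i`) or `y_j` (for `v = Sum.inr j`). -/
def lvar (k : Type*) [Field k] {m n : ℕ} (v : Fin m ⊕ Fin n) : Laurent k m n :=
  AddMonoidAlgebra.single (Finsupp.single v 1) 1

/-- The partial derivative with respect to the variable `v`; it sends the monomial with exponent
vector `a` to `a_v` times the monomial with exponent vector `a - e_v`. -/
def lpderiv (k : Type*) [Field k] {m n : ℕ} (v : Fin m ⊕ Fin n) :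
    Laurent k m n →ₗ[k] Laurent k m n :=
  (Finsupp.lsum k fun a : (Fin m ⊕ Fin n) →₀ ℤ =>
      ((a v : ℤ) : k) • AddMonoidAlgebra.lsingle (a - Finsupp.single v 1)) ∘ₗ
    (AddMonoidAlgebra.coeffLinearEquiv k).toLinearMap

theorem lpderiv_single (k : Type*) [Field k] {m n : ℕ} (v : Fin m ⊕ Fin n)
    (a : (Fin m ⊕ Fin n) →₀ ℤ) (c : k) :
    lpderiv k v (AddMonoidAlgebra.single a c) =
      AddMonoidAlgebra.single (a - Finsupp.single v 1) (((a v : ℤ) : k) * c) := by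
  simp [lpderiv]

theorem lpderiv_mul (k : Type*) [Field k] {m n : ℕ} (v : Fin m ⊕ Fin n) (f g : Laurent k m n) :
    lpderiv k v (f * g) = f * lpderiv k v g + g * lpderiv k v f := by
  induction f using AddMonoidAlgebra.induction_linear with
  | zero => simp
  | add f₁ f₂ h₁ h₂ => rw [add_mul, map_add, h₁, h₂, map_add]; ring
  | single a c =>
    induction g using AddMonoidAlgebra.induction_linear with
    | zero => simp
    | add g₁ g₂ h₁ h₂ => rw [mul_add, map_add, h₁, h₂, map_add]; ring
    | single b d =>
      simp only [AddMonoidAlgebra.single_mul_single, lpderiv_single]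
      rw [show a + (b - Finsupp.single v 1) = a + b - Finsupp.single v 1 by abel,
        show b + (a - Finsupp.single v 1) = a + b - Finsupp.single v 1 by abel,
        ← AddMonoidAlgebra.single_add]
      congr 1
      simp only [Finsupp.add_apply, Int.cast_add]
      ring

/-- The `k`-algebra of Laurent supersymmetric polynomials in `x_1, …, x_m | y_1, …, y_n`: the
Laurent polynomials that are invariant under `S_m × S_n` and for which
`x_i ∂f/∂x_i + y_j ∂f/∂y_j` lies in the ideal generated by `x_i - y_j`, for all `i` and `j`. -/
def superLaurent (k : Type*) [Field k] (m n : ℕ) : Subalgebra k (Laurent k m n) where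
  carrier := {f |
    (∀ (σ : Equiv.Perm (Fin m)) (τ : Equiv.Perm (Fin n)),
      AddMonoidAlgebra.domCongr k k (Finsupp.domCongr (Equiv.sumCongr σ τ)) f = f) ∧
    (∀ (i : Fin m) (j : Fin n),
      lvar k (Sum.inl i) * lpderiv k (Sum.inl i) f + lvar k (Sum.inr j) * lpderiv k (Sum.inr j) f ∈
        Ideal.span {(lvar k (Sum.inl i) - lvar k (Sum.inr j) : Laurent k m n)})}
  mul_mem' := by
    rintro f g ⟨hf, hf'⟩ ⟨hg, hg'⟩
    refine ⟨fun σ τ => ?_, fun i j => ?_⟩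
    · rw [map_mul, hf, hg]
    · have h := Ideal.add_mem _ (Ideal.mul_mem_left _ f (hg' i j))
        (Ideal.mul_mem_left _ g (hf' i j))
      rw [lpderiv_mul, lpderiv_mul]
      convert h using 1
      ring
  add_mem' := by
    rintro f g ⟨hf, hf'⟩ ⟨hg, hg'⟩
    refine ⟨fun σ τ => ?_, fun i j => ?_⟩
    · rw [map_add, hf, hg]
    · have h := Ideal.add_mem _ (hf' i j) (hg' i j)
      rw [map_add, map_add]
      convert h using 1
      ring
  algebraMap_mem' := by
    intro r
    refine ⟨fun σ τ => ?_, fun i j => ?_⟩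
    · rw [AlgEquiv.commutes]
    · have h : ∀ v : Fin m ⊕ Fin n, lpderiv k v (algebraMap k (Laurent k m n) r) = 0 := by
        intro v
        rw [show algebraMap k (Laurent k m n) r = AddMonoidAlgebra.single 0 r from rfl,
          lpderiv_single]
        simp
      rw [h, h]
      simp

/-- Evaluation of a Laurent polynomial at a point of the torus: the monomial with exponent vector
`a` is sent to `∏_v p_v ^ a_v`. -/
def evalTorus (k : Type*) [Field k] (m n : ℕ) (p : Fin m ⊕ Fin n → kˣ) : Laurent k m n →ₐ[k] k :=
  AddMonoidAlgebra.lift k k ((Fin m ⊕ Fin n) →₀ ℤ)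
    { toFun := fun a => ∏ v, (p v : k) ^ (Multiplicative.toAdd a v)
      map_one' := by simp
      map_mul' := by
        intro a b
        rw [← Finset.prod_mul_distrib]
        refine Finset.prod_congr rfl fun v _ => ?_
        rw [toAdd_mul, Finsupp.add_apply, zpow_add₀ (p v).ne_zero] }

/-- Evaluation of a Laurent supersymmetric polynomial at a point of
`(k^*)^{m|n} = (k^*)^m × (k^*)^n`. -/
def evalLaurent (k : Type*) [Field k] (m n : ℕ) (p : Fin m ⊕ Fin n → kˣ) :
    superLaurent k m n →ₐ[k] k :=
  (evalTorus k m n p).comp (superLaurent k m n).val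

/-! ### The maps `V` and `I_A`

These are written for an algebra `A` whose elements are evaluated at the points of a set `X`
through `ev : X → A →ₐ[k] k`; they are used with `evalPoly` and `evalLaurent`. -/

/-- `V(E)`, the set of common zeros of a subset `E` of `A`. -/
def zeros {k A X : Type*} [Field k] [CommRing A] [Algebra k A] (ev : X → A →ₐ[k] k)
    (E : Set A) : Set X :=
  {p | ∀ f ∈ E, ev p f = 0}

/-- `I_A(V)`, the ideal of the elements of `A` that vanish at every point of `V`. -/
def vanishing {k A X : Type*} [Field k] [CommRing A] [Algebra k A] (ev : X → A →ₐ[k] k)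
    (V : Set X) : Ideal A where
  carrier := {f | ∀ p ∈ V, ev p f = 0}
  add_mem' := by
    intro f g hf hg p hp
    rw [map_add, hf p hp, hg p hp, add_zero]
  zero_mem' := fun p _ => map_zero (ev p)
  smul_mem' := by
    intro c f hf p hp
    rw [smul_eq_mul, map_mul, hf p hp, mul_zero]

/-- A superalgebraic set is a set of the form `V(E)` for some subset `E` of `A`. -/
def IsSuperalgebraic {k A X : Type*} [Field k] [CommRing A] [Algebra k A] (ev : X → A →ₐ[k] k)
    (V : Set X) : Prop :=
  ∃ E : Set A, V = zeros ev E

end Supersym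

end

noncomputable section

namespace Supersym

/-! Both cases are treated as algebras of functions on `C ^ (m|n)`, with `C` the affine line (after
changing the sign of the `y_j`) or the punctured line. In both, supersymmetry then means: symmetric,
and independent of the common value of `x_i` and `y_j` on the locus `x_i = y_j`. The algebra is in
general not finitely generated, so the classical Nullstellensatz does not apply to it directly.

The strong Nullstellensatz (`mem_radical_of_forall`) is proved by induction along the restriction
`res` to `x_0 = y_0`, which removes one variable of each kind. Its kernel J consists of the
supersymmetric functions vanishing on all loci `x_i = y_j`, and it absorbs multiplication by every
symmetric regular function. Let `f` vanish on the zeros of an ideal I. The classical Nullstellensatz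
puts some `f ^ N` in the ideal that I generates among all regular functions; averaging over `S_m ×
S_n` gives `J * f ^ N ⊆ I`. By induction `res f ^ M` lies in the image of I, so `f ^ M - g ∈ J` for
some `g ∈ I`, and `f ^ (M + N) = (f ^ M - g) * f ^ N + f ^ N * g` lies in I. If `m = 0` or `n = 0`,
then J is everything.

This needs `res` to be surjective. The interpolation sum over i, j of `f(x without x_i | y without
y_j) * ∏ (y_l - x_i) * ∏ (x_l - y_j) / (∏ (x_l - x_i) * ∏ (y_l - y_j))`, with the products over the
remaining indices, is an iterated divided difference, hence regular. It defines `lift` with `res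
(lift f) = f + lift (res f)`, where the second term is absent if `m = 0` or `n = 0`. In
characteristic zero this can be solved for preimages recursively.

For the failure of the Noetherian property, let Δ be the product of all `x_i - y_j` and s the sum of
the `x_i`. If `Δ s ^ N` were a combination of the `Δ s ^ i` with `i < N`, then s would satisfy a
monic equation with supersymmetric coefficients. On `x_0 = y_0 = t` these coefficients do not depend
on t, while s takes infinitely many values. -/

/-- A set `C` of values for the coordinates, embedded in the field by `z`, together with finitely
many functions on `C` that generate its ring of regular functions. -/
structure CoordData (k : Type*) [Field k] (C : Type*) where
  /-- the coordinate -/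
  z : C → k
  /-- the generators of the ring of regular functions -/
  gens : Set (C → k)
  /-- a base point -/
  base : C
  z_injective : Function.Injective z
  z_mem : z ∈ gens
  finite_gens : gens.Finite
  exists_point : ∀ χ : Algebra.adjoin k gens →ₐ[k] k, ∃ c, ∀ φ (h : φ ∈ gens),
    χ ⟨φ, Algebra.subset_adjoin h⟩ = φ c
  divided_difference : ∀ φ ∈ gens, ∃ a ∈ Algebra.adjoin k gens, ∃ b ∈ Algebra.adjoin k gens,
    ∀ s t, φ s - φ t = (z s - z t) * (a s * b t)
  eq_zero_of_eq_zero_off : ∀ f ∈ Algebra.adjoin k gens, ∀ c, (∀ d, d ≠ c → f d = 0) → f = 0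

/-! ### Regular functions on powers of the curve: density, division, divided differences. -/

namespace CoordData

variable {k C : Type*} [Field k] (D : CoordData k C) {ι κ : Type*}

/-- The regular functions on `C ^ ι`. -/
def reg (ι : Type*) : Subalgebra k ((ι → C) → k) :=
  Algebra.adjoin k {F | ∃ φ ∈ D.gens, ∃ v : ι, F = fun p => φ (p v)}

variable {D}

theorem gen_mem_reg {φ : C → k} (h : φ ∈ D.gens) (v : ι) : (fun p : ι → C => φ (p v)) ∈ D.reg ι :=
  Algebra.subset_adjoin ⟨φ, h, v, rfl⟩

theorem z_mem_reg (v : ι) : (fun p : ι → C => D.z (p v)) ∈ D.reg ι :=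
  gen_mem_reg D.z_mem v

theorem sub_mem_reg (v w : ι) : (fun p : ι → C => D.z (p v) - D.z (p w)) ∈ D.reg ι :=
  (D.reg ι).sub_mem (z_mem_reg v) (z_mem_reg w)

theorem const_mem_reg (c : k) : (fun _ : ι → C => c) ∈ D.reg ι :=
  (D.reg ι).algebraMap_mem c

/-- Composition with a map, as a homomorphism of algebras of functions. -/
def compHom {X Y : Type*} (G : Y → X) : (X → k) →ₐ[k] (Y → k) where
  toFun f := f ∘ G
  map_one' := rfl
  map_mul' _ _ := rfl
  map_zero' := rfl
  map_add' _ _ := rfl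
  commutes' _ := rfl

theorem comp_mem_adjoin {X Y : Type*} {S : Set (X → k)} {B : Subalgebra k (Y → k)} (G : Y → X)
    (h : ∀ f ∈ S, f ∘ G ∈ B) {f : X → k} (hf : f ∈ Algebra.adjoin k S) : f ∘ G ∈ B := by
  have : Algebra.adjoin k S ≤ B.comap (compHom G) := Algebra.adjoin_le h
  exact this hf

theorem adjoin_comp_mem_reg {a : C → k} (h : a ∈ Algebra.adjoin k D.gens) (v : ι) :
    (fun p : ι → C => a (p v)) ∈ D.reg ι :=
  comp_mem_adjoin (fun p : ι → C => p v) (fun _ hφ => gen_mem_reg hφ v) h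

/-- Each coordinate may be replaced by a coordinate or by a constant. -/
theorem subst_mem_reg (g : ι → κ ⊕ C) {f : (ι → C) → k} (hf : f ∈ D.reg ι) :
    (fun p : κ → C => f (fun v => Sum.elim p id (g v))) ∈ D.reg κ := by
  refine comp_mem_adjoin (fun (p : κ → C) v => Sum.elim p id (g v)) ?_ hf
  rintro _ ⟨φ, hφ, v, rfl⟩
  rcases h : g v with w | c
  · simpa [Function.comp_def, h] using gen_mem_reg hφ w
  · simpa [Function.comp_def, h] using const_mem_reg (φ c)

theorem rename_mem_reg (g : ι → κ) {f : (ι → C) → k} (hf : f ∈ D.reg ι) :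
    (fun p : κ → C => f (p ∘ g)) ∈ D.reg κ :=
  subst_mem_reg (fun v => Sum.inl (g v)) hf

theorem update_mem_adjoin [DecidableEq ι] {f : (ι → C) → k} (hf : f ∈ D.reg ι) (p : ι → C)
    (v : ι) : (fun t => f (Function.update p v t)) ∈ Algebra.adjoin k D.gens := by
  refine comp_mem_adjoin (fun t => Function.update p v t) ?_ hf
  rintro _ ⟨φ, hφ, w, rfl⟩
  by_cases h : w = v
  · subst h
    simpa [Function.comp_def] using Algebra.subset_adjoin hφ
  · simp only [Function.comp_def, Function.update_of_ne h]
    exact (Algebra.adjoin k D.gens).algebraMap_mem (φ (p w))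

/-- With the other coordinates fixed, the coordinate at `v` runs over the complement of one point,
which is dense in `C`. -/
theorem eq_zero_of_ne {f : (ι → C) → k} (hf : f ∈ D.reg ι) {v w : ι} (hvw : v ≠ w)
    (h : ∀ p, p v ≠ p w → f p = 0) : f = 0 := by
  classical
  funext p
  have := D.eq_zero_of_eq_zero_off _ (update_mem_adjoin hf p v) (p w) fun d hd => h _ (by
    simpa [Function.update_of_ne hvw.symm] using hd)
  simpa using congrFun this (p v)

/-- A regular function that vanishes at all points with distinct coordinates is zero. -/
theorem eq_zero_of_injective [Finite ι] {f : (ι → C) → k} (hf : f ∈ D.reg ι)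
    (h : ∀ p, Function.Injective p → f p = 0) : f = 0 := by
  classical
  cases nonempty_fintype ι
  -- The pairs required to be distinct are removed one at a time: multiplying by the difference of
  -- two coordinates drops their condition, and `eq_zero_of_ne` then cancels that factor.
  have key : ∀ (S : Finset (ι × ι)) (f : (ι → C) → k), f ∈ D.reg ι →
      (∀ p, (∀ a ∈ S, a.1 ≠ a.2 → p a.1 ≠ p a.2) → f p = 0) → f = 0 := by
    intro S
    induction S using Finset.induction_on with
    | empty => exact fun f _ h => funext fun p => h p (by simp)
    | insert a S ha ih =>
      intro f hf h
      by_cases hvw : a.1 = a.2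
      · exact ih f hf fun p hp => h p fun b hb hne => by
          rcases Finset.mem_insert.1 hb with rfl | hb
          · exact absurd hvw hne
          · exact hp b hb hne
      · have := ih _ ((D.reg ι).mul_mem hf (sub_mem_reg a.1 a.2)) fun p hp => by
          by_cases hpa : p a.1 = p a.2
          · simp [hpa]
          · have : f p = 0 := h p fun b hb hne => by
              rcases Finset.mem_insert.1 hb with rfl | hb
              · exact hpa
              · exact hp b hb hne
            simp [this]
        refine eq_zero_of_ne hf hvw fun p hp => ?_
        have := congrFun this p
        simpa [sub_eq_zero, D.z_injective.eq_iff, hp] using this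
  refine key Finset.univ f hf fun p hp => h p fun v w hvw => ?_
  by_contra hne
  exact hp (v, w) (Finset.mem_univ _) hne hvw

theorem eq_of_injective [Finite ι] {f g : (ι → C) → k} (hf : f ∈ D.reg ι) (hg : g ∈ D.reg ι)
    (h : ∀ p, Function.Injective p → f p = g p) : f = g :=
  sub_eq_zero.1 (eq_zero_of_injective ((D.reg ι).sub_mem hf hg) fun p hp => by simp [h p hp])

/-- The generators have divided differences by assumption, and the Leibniz rule extends this to
products. -/
theorem exists_sub_update_eq [DecidableEq ι] (v w : ι) {f : (ι → C) → k} (hf : f ∈ D.reg ι) :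
    ∃ h ∈ D.reg ι, ∀ p, f p - f (Function.update p v (p w)) = (D.z (p v) - D.z (p w)) * h p := by
  induction hf using Algebra.adjoin_induction with
  | mem f hf =>
    obtain ⟨φ, hφ, u, rfl⟩ := hf
    by_cases hu : u = v
    · subst hu
      obtain ⟨a, ha, b, hb, hab⟩ := D.divided_difference φ hφ
      exact ⟨_, (D.reg ι).mul_mem (adjoin_comp_mem_reg ha u) (adjoin_comp_mem_reg hb w),
        fun p => by simpa using hab (p u) (p w)⟩
    · exact ⟨0, (D.reg ι).zero_mem, fun p => by simp [hu]⟩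
  | algebraMap c => exact ⟨0, (D.reg ι).zero_mem, fun p => by simp⟩
  | add f g _ _ hf hg =>
    obtain ⟨a, ha, ha'⟩ := hf
    obtain ⟨b, hb, hb'⟩ := hg
    exact ⟨a + b, (D.reg ι).add_mem ha hb, fun p => by
      simp only [Pi.add_apply]
      linear_combination ha' p + hb' p⟩
  | mul f g hfm hgm hf hg =>
    obtain ⟨a, ha, ha'⟩ := hf
    obtain ⟨b, hb, hb'⟩ := hg
    have hg' : (fun p : ι → C => g (Function.update p v (p w))) ∈ D.reg ι := by
      have := rename_mem_reg (D := D) (Function.update id v w) hgm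
      convert this using 2 with p
      congr 1
      funext u
      by_cases hu : u = v
      · subst hu; simp
      · simp [hu]
    exact ⟨f * b + _ * a, (D.reg ι).add_mem ((D.reg ι).mul_mem hfm hb)
      ((D.reg ι).mul_mem hg' ha), fun p => by
      simp only [Pi.add_apply, Pi.mul_apply]
      linear_combination f p * hb' p + g (Function.update p v (p w)) * ha' p⟩

theorem exists_eq_sub_mul {v w : ι} {f : (ι → C) → k} (hf : f ∈ D.reg ι)
    (h : ∀ p, p v = p w → f p = 0) :
    ∃ g ∈ D.reg ι, ∀ p, f p = (D.z (p v) - D.z (p w)) * g p := by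
  classical
  obtain ⟨g, hg, hfg⟩ := exists_sub_update_eq v w hf
  refine ⟨g, hg, fun p => ?_⟩
  rw [← hfg, h (Function.update p v (p w)), sub_zero]
  by_cases hvw : w = v
  · subst hvw; rfl
  · simp [hvw]

/-- Up to sign, this is the coefficient of degree `N + 1` in the Lagrange interpolation of the
constant 1 at `N + 2` nodes. -/
theorem sum_prod_inv_eq_zero {N : ℕ} (v : Fin (N + 2) → k) (hv : Function.Injective v) :
    ∑ i, (∏ l, (v (i.succAbove l) - v i))⁻¹ = 0 := by
  have h := Lagrange.coeff_eq_sum (s := Finset.univ) (v := v) hv.injOn (P := (1 : Polynomial k))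
    (by rw [Polynomial.degree_one]; simp; exact_mod_cast Nat.succ_pos (N+1))
  have h1 : ∀ i, (∏ l, (v (i.succAbove l) - v i))⁻¹ =
      (-1) ^ (N + 1) * (1 / ∏ j ∈ Finset.univ.erase i, (v i - v j)) := by
    intro i
    have : ∏ j ∈ Finset.univ.erase i, (v i - v j) = ∏ l, (v i - v (i.succAbove l)) := by
      have himg : Finset.univ.erase i = Finset.univ.image i.succAbove := by
        ext j
        simp
      rw [himg, Finset.prod_image fun a _ b _ hab => Fin.succAbove_right_injective hab]
    rw [this, show (∏ l, (v (i.succAbove l) - v i)) = ∏ l, (-1) * (v i - v (i.succAbove l)) from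
      Finset.prod_congr rfl fun l _ => by ring, Finset.prod_mul_distrib]
    simp
    rcases Nat.even_or_odd N with hN | hN <;> simp [pow_succ, hN.neg_one_pow]
  simp only [h1, ← Finset.mul_sum]
  simp only [Polynomial.eval_one] at h
  rw [← h]
  simp [Polynomial.coeff_one]

/-- Newton's divided difference of a compatible family of regular functions is regular. -/
theorem exists_divided_difference (N : ℕ) (e : Fin (N + 1) → ι)
    (he : Function.Injective e)
    (g : Fin (N + 1) → (ι → C) → k) (hg : ∀ i, g i ∈ D.reg ι)
    (hgg : ∀ i j p, p (e i) = p (e j) → g i p = g j p) :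
    ∃ h ∈ D.reg ι, ∀ p, Function.Injective (p ∘ e) →
      h p = ∑ i, g i p * (∏ l, (D.z (p (e (i.succAbove l))) - D.z (p (e i))))⁻¹ := by
  induction N with
  | zero => exact ⟨g 0, hg 0, fun p _ => by simp⟩
  | succ N ih =>
    -- Newton's recursion: divide the differences from `g 0` by the differences of nodes, and apply
    -- the induction hypothesis to the quotients.
    have H : ∀ i : Fin (N + 1), ∃ h ∈ D.reg ι, ∀ p,
        g i.succ p - g 0 p = (D.z (p (e 0)) - D.z (p (e i.succ))) * h p := fun i =>
      exists_eq_sub_mul ((D.reg ι).sub_mem (hg i.succ) (hg 0)) fun p hp => by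
        simp [hgg i.succ 0 p hp.symm]
    choose d hd hgd using H
    obtain ⟨h, hh, hhd⟩ := ih (e ∘ Fin.succ) (he.comp (Fin.succ_injective _)) d hd (by
      intro i j p hp
      by_cases hij : i = j
      · rw [hij]
      classical
      have h0 : ∀ i : Fin (N + 1), e 0 ≠ e i.succ := fun i h =>
        (Fin.succ_ne_zero i).symm (he h)
      -- Compatibility of the quotients follows by cancelling a difference of nodes, which is
      -- possible only where it is nonzero. Varying the coordinate `e 0` and using density covers
      -- the remaining points.
      have hne : ∀ q : ι → C, q (e 0) ≠ q (e i.succ) →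
          q (e i.succ) = q (e j.succ) → d i q = d j q := by
        intro q hq hq'
        have h1 := hgd i q
        have h2 := hgd j q
        rw [hgg i.succ j.succ q hq', hq', h2] at h1
        refine (mul_left_cancel₀ ?_ h1).symm
        rw [← hq', sub_ne_zero]
        exact fun h => hq (D.z_injective h)
      have := D.eq_zero_of_eq_zero_off _ (update_mem_adjoin ((D.reg ι).sub_mem (hd i) (hd j)) p
        (e 0)) (p (e i.succ)) fun c hc => by
          have := hne (Function.update p (e 0) c) (by
            rwa [Function.update_self, Function.update_of_ne (h0 i).symm]) (by
            rw [Function.update_of_ne (h0 i).symm, Function.update_of_ne (h0 j).symm]; exact hp)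
          simp [this]
      have := congrFun this (p (e 0))
      simpa [sub_eq_zero] using this)
    refine ⟨h, hh, fun p hp => ?_⟩
    have hS := sum_prod_inv_eq_zero (fun i => D.z (p (e i)))
      (D.z_injective.comp hp)
    rw [Fin.sum_univ_succ] at hS
    rw [hhd p (hp.comp (Fin.succ_injective _)), Fin.sum_univ_succ (n := N + 1)]
    have key : ∀ i : Fin (N + 1),
        d i p * (∏ l, (D.z (p ((e ∘ Fin.succ) (i.succAbove l))) -
          D.z (p ((e ∘ Fin.succ) i))))⁻¹ =
        (g i.succ p - g 0 p) *
          (∏ l, (D.z (p (e (i.succ.succAbove l))) - D.z (p (e i.succ))))⁻¹ := by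
      intro i
      have h0 : D.z (p (e 0)) - D.z (p (e i.succ)) ≠ 0 := by
        rw [sub_ne_zero]
        exact fun h => (Fin.succ_ne_zero i).symm (hp (D.z_injective h))
      rw [hgd, Fin.prod_univ_succ (n := N)]
      simp only [Fin.succ_succAbove_zero, Fin.succ_succAbove_succ, Function.comp_apply, mul_inv]
      field_simp
    -- The terms with `g 0` combine into its own summand because the inverse products sum to zero.
    simp only [key, sub_mul, Finset.sum_sub_distrib, ← Finset.mul_sum]
    linear_combination (-g 0 p) * hS

end CoordData

/-! ### Supersymmetric functions, their restriction, and the interpolation sum. -/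

namespace CoordData

variable {k C : Type*} [Field k] (D : CoordData k C) {m n : ℕ}

/-- The supersymmetric regular functions: invariant under permutations, and independent of the
common value of `x_i` and `y_j` on the locus `x_i = y_j`. -/
def superReg (m n : ℕ) : Subalgebra k ((Fin m ⊕ Fin n → C) → k) where
  carrier := {f | f ∈ D.reg (Fin m ⊕ Fin n) ∧
    (∀ (σ : Equiv.Perm (Fin m)) (τ : Equiv.Perm (Fin n)) (p : Fin m ⊕ Fin n → C),
      f (p ∘ Sum.map σ τ) = f p) ∧
    ∀ (i : Fin m) (j : Fin n) (p q : Fin m ⊕ Fin n → C), p (Sum.inl i) = p (Sum.inr j) →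
      q (Sum.inl i) = q (Sum.inr j) → (∀ v, v ≠ Sum.inl i → v ≠ Sum.inr j → p v = q v) →
      f p = f q}
  mul_mem' := fun {f g} hf hg => ⟨(D.reg _).mul_mem hf.1 hg.1,
    fun σ τ p => by simp only [Pi.mul_apply, hf.2.1, hg.2.1],
    fun i j p q h1 h2 h3 => by
      simp only [Pi.mul_apply, hf.2.2 i j p q h1 h2 h3, hg.2.2 i j p q h1 h2 h3]⟩
  add_mem' := fun {f g} hf hg => ⟨(D.reg _).add_mem hf.1 hg.1,
    fun σ τ p => by simp only [Pi.add_apply, hf.2.1, hg.2.1],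
    fun i j p q h1 h2 h3 => by
      simp only [Pi.add_apply, hf.2.2 i j p q h1 h2 h3, hg.2.2 i j p q h1 h2 h3]⟩
  algebraMap_mem' := fun r => ⟨(D.reg _).algebraMap_mem r, fun _ _ _ => rfl, fun _ _ _ _ _ _ _ => rfl⟩

/-- The point with the value `t` inserted as first coordinate in both groups. -/
def ext (t : C) (p : Fin m ⊕ Fin n → C) : Fin (m + 1) ⊕ Fin (n + 1) → C :=
  Sum.elim (Fin.cons t (p ∘ Sum.inl)) (Fin.cons t (p ∘ Sum.inr))

/-- The point with one coordinate in each group removed. -/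
def del (i : Fin (m + 1)) (j : Fin (n + 1)) (p : Fin (m + 1) ⊕ Fin (n + 1) → C) :
    Fin m ⊕ Fin n → C :=
  p ∘ Sum.map i.succAbove j.succAbove

variable {D}

@[simp] theorem ext_inl_zero (t : C) (p : Fin m ⊕ Fin n → C) : ext t p (Sum.inl 0) = t := rfl
@[simp] theorem ext_inr_zero (t : C) (p : Fin m ⊕ Fin n → C) : ext t p (Sum.inr 0) = t := rfl
@[simp] theorem ext_inl_succ (t : C) (p : Fin m ⊕ Fin n → C) (i : Fin m) :
    ext t p (Sum.inl i.succ) = p (Sum.inl i) := rfl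
@[simp] theorem ext_inr_succ (t : C) (p : Fin m ⊕ Fin n → C) (j : Fin n) :
    ext t p (Sum.inr j.succ) = p (Sum.inr j) := rfl

theorem ext_del_zero {p : Fin (m + 1) ⊕ Fin (n + 1) → C} (h : p (Sum.inl 0) = p (Sum.inr 0)) :
    ext (p (Sum.inl 0)) (del 0 0 p) = p := by
  funext v
  rcases v with i | j
  · cases i using Fin.cases <;> simp [del]
  · cases j using Fin.cases <;> simp [del, h]

@[simp] theorem del_zero_ext (t : C) (p : Fin m ⊕ Fin n → C) : del 0 0 (ext t p) = p := by
  funext v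
  rcases v with i | j <;> simp [del]

@[simp] theorem del_succ_ext (t : C) (p : Fin (m + 1) ⊕ Fin (n + 1) → C) (i : Fin (m + 1))
    (j : Fin (n + 1)) : del i.succ j.succ (ext t p) = ext t (del i j p) := by
  funext v
  rcases v with a | b
  · cases a using Fin.cases <;> simp [del]
  · cases b using Fin.cases <;> simp [del]

/-- By symmetry any pair `(i, j)` can be moved to `(0, 0)`. -/
theorem mem_superReg_of_ext {f : (Fin (m + 1) ⊕ Fin (n + 1) → C) → k} (h1 : f ∈ D.reg _)
    (h2 : ∀ (σ : Equiv.Perm (Fin (m + 1))) (τ : Equiv.Perm (Fin (n + 1))) p,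
      f (p ∘ Sum.map σ τ) = f p)
    (h3 : ∀ s t p, f (ext s p) = f (ext t p)) : f ∈ D.superReg (m + 1) (n + 1) := by
  refine ⟨h1, h2, fun i j p q hp hq hpq => ?_⟩
  rw [← h2 (Equiv.swap 0 i) (Equiv.swap 0 j) p, ← h2 (Equiv.swap 0 i) (Equiv.swap 0 j) q]
  rw [← ext_del_zero (p := p ∘ _) (by simpa using hp),
    ← ext_del_zero (p := q ∘ _) (by simpa using hq)]
  have : del 0 0 (p ∘ Sum.map (Equiv.swap 0 i) (Equiv.swap 0 j)) =
      del 0 0 (q ∘ Sum.map (Equiv.swap 0 i) (Equiv.swap 0 j)) := by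
    funext v
    rcases v with a | b
    · refine hpq _ (fun h => ?_) (by simp)
      have h' := Sum.inl_injective h
      have := (Equiv.swap 0 i).injective (h'.trans (Equiv.swap_apply_left 0 i).symm)
      exact Fin.succ_ne_zero _ this
    · refine hpq _ (by simp) (fun h => ?_)
      have h' := Sum.inr_injective h
      have := (Equiv.swap 0 j).injective (h'.trans (Equiv.swap_apply_left 0 j).symm)
      exact Fin.succ_ne_zero _ this
  rw [this]
  exact h3 _ _ _

theorem apply_ext_eq {f : (Fin (m + 1) ⊕ Fin (n + 1) → C) → k}
    (hf : f ∈ D.superReg (m + 1) (n + 1)) (s t : C) (p : Fin m ⊕ Fin n → C) :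
    f (ext s p) = f (ext t p) := by
  refine hf.2.2 0 0 _ _ rfl rfl fun v h1 h2 => ?_
  rcases v with i | j
  · cases i using Fin.cases
    · exact absurd rfl h1
    · rfl
  · cases j using Fin.cases
    · exact absurd rfl h2
    · rfl

/-- The substitution behind `ext`, with the inserted value as an extra coordinate. -/
theorem ext_mem_reg {f : (Fin (m + 1) ⊕ Fin (n + 1) → C) → k} (hf : f ∈ D.reg _) :
    (fun q : Option (Fin m ⊕ Fin n) → C => f (ext (q none) (q ∘ some))) ∈ D.reg _ := by
  have := rename_mem_reg (D := D) (κ := Option (Fin m ⊕ Fin n))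
    (Sum.elim (Fin.cons none (some ∘ Sum.inl)) (Fin.cons none (some ∘ Sum.inr))) hf
  convert this using 3 with q
  funext v
  rcases v with i | j
  · cases i using Fin.cases <;> simp
  · cases j using Fin.cases <;> simp

theorem ext_base_mem_reg (t : C) {f : (Fin (m + 1) ⊕ Fin (n + 1) → C) → k} (hf : f ∈ D.reg _) :
    (fun q : Fin m ⊕ Fin n → C => f (ext t q)) ∈ D.reg _ := by
  have := subst_mem_reg (D := D) (κ := Fin m ⊕ Fin n)
    (Sum.elim (Fin.cons (Sum.inr t) (Sum.inl ∘ Sum.inl))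
      (Fin.cons (Sum.inr t) (Sum.inl ∘ Sum.inr))) hf
  convert this using 3 with q
  funext v
  rcases v with i | j
  · cases i using Fin.cases <;> simp
  · cases j using Fin.cases <;> simp

variable (D) in
/-- The restriction to the locus `x_0 = y_0`, on which the functions do not depend on the common
value of these two coordinates. -/
def res (m n : ℕ) : D.superReg (m + 1) (n + 1) →ₐ[k] D.superReg m n where
  toFun f := ⟨fun p => f.1 (ext D.base p), ext_base_mem_reg _ f.2.1, by
      intro σ τ p
      refine Eq.trans (congrArg f.1 ?_) (f.2.2.1 (Equiv.Perm.decomposeFin.symm (0, σ))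
        (Equiv.Perm.decomposeFin.symm (0, τ)) (ext D.base p))
      funext v
      rcases v with i | j
      · cases i using Fin.cases <;> simp
      · cases j using Fin.cases <;> simp, by
      intro i j p q hp hq hpq
      refine f.2.2.2 i.succ j.succ _ _ (by simpa) (by simpa) fun v h1 h2 => ?_
      rcases v with a | b
      · cases a using Fin.cases
        · rfl
        · exact hpq _ (by simpa using h1) (by simp)
      · cases b using Fin.cases
        · rfl
        · exact hpq _ (by simp) (by simpa using h2)⟩
  map_one' := rfl
  map_mul' _ _ := rfl
  map_zero' := rfl
  map_add' _ _ := rfl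
  commutes' _ := rfl

theorem res_apply (f : D.superReg (m + 1) (n + 1)) (p : Fin m ⊕ Fin n → C) (t : C) :
    (D.res m n f).1 p = f.1 (ext t p) :=
  apply_ext_eq f.2 _ _ _

theorem res_eq_zero_iff (f : D.superReg (m + 1) (n + 1)) :
    D.res m n f = 0 ↔ ∀ p i j, p (Sum.inl i) = p (Sum.inr j) → f.1 p = 0 := by
  constructor
  · intro h p i j hp
    rw [← f.2.2.1 (Equiv.swap 0 i) (Equiv.swap 0 j) p,
      ← ext_del_zero (p := p ∘ _) (by simpa using hp), ← res_apply, h]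
    rfl
  · intro h
    ext p
    exact h _ 0 0 rfl

theorem exists_perm_succAbove (π : Equiv.Perm (Fin (m + 1))) (i : Fin (m + 1)) :
    ∃ σ : Equiv.Perm (Fin m), ∀ l, π (i.succAbove l) = (π i).succAbove (σ l) := by
  have : ∀ l, ∃ l', (π i).succAbove l' = π (i.succAbove l) := fun l =>
    Fin.exists_succAbove_eq fun h => Fin.succAbove_ne i l (π.injective h)
  choose σ hσ using this
  have hinj : Function.Injective σ := fun a b hab => by
    have := (hσ a).symm.trans ((congrArg _ hab).trans (hσ b))
    exact Fin.succAbove_right_injective (π.injective this)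
  exact ⟨Equiv.ofBijective σ (Finite.injective_iff_bijective.1 hinj), fun l => (hσ l).symm⟩

variable (D) in
/-- The numerators of the summands of `liftSum`. -/
def liftNum (f : (Fin m ⊕ Fin n → C) → k) (p : Fin (m + 1) ⊕ Fin (n + 1) → C) (i : Fin (m + 1))
    (j : Fin (n + 1)) : k :=
  f (del i j p) * ((∏ l, (D.z (p (Sum.inr (j.succAbove l))) - D.z (p (Sum.inl i)))) *
    ∏ l, (D.z (p (Sum.inl (i.succAbove l))) - D.z (p (Sum.inr j))))

variable (D) in
/-- The interpolation sum that lifts a supersymmetric function to one pair of variables more. -/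
def liftSum (f : (Fin m ⊕ Fin n → C) → k) (p : Fin (m + 1) ⊕ Fin (n + 1) → C) : k :=
  ∑ j, (∑ i, D.liftNum f p i j *
      (∏ l, (D.z (p (Sum.inl (i.succAbove l))) - D.z (p (Sum.inl i))))⁻¹) *
    (∏ l, (D.z (p (Sum.inr (j.succAbove l))) - D.z (p (Sum.inr j))))⁻¹

theorem liftNum_mem_reg {f : (Fin m ⊕ Fin n → C) → k} (hf : f ∈ D.reg _) (i : Fin (m + 1))
    (j : Fin (n + 1)) : (fun p => D.liftNum f p i j) ∈ D.reg _ := by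
  refine (D.reg _).mul_mem (rename_mem_reg _ hf) ((D.reg _).mul_mem ?_ ?_)
  · convert (D.reg (Fin (m + 1) ⊕ Fin (n + 1))).prod_mem (t := Finset.univ) fun l _ =>
      sub_mem_reg (Sum.inr (j.succAbove l)) (Sum.inl i) using 1
    funext p
    simp
  · convert (D.reg (Fin (m + 1) ⊕ Fin (n + 1))).prod_mem (t := Finset.univ) fun l _ =>
      sub_mem_reg (Sum.inl (i.succAbove l)) (Sum.inr j) using 1
    funext p
    simp

theorem prod_comp_succAbove (π : Equiv.Perm (Fin (m + 1))) (i : Fin (m + 1))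
    (F : Fin (m + 1) → k) :
    ∏ l, F (π (i.succAbove l)) = ∏ l, F ((π i).succAbove l) := by
  obtain ⟨σ, hσ⟩ := exists_perm_succAbove π i
  simp only [hσ]
  exact Equiv.prod_comp σ fun l => F ((π i).succAbove l)

theorem liftNum_comp {f : (Fin m ⊕ Fin n → C) → k} (hf : f ∈ D.superReg m n)
    (σ : Equiv.Perm (Fin (m + 1))) (τ : Equiv.Perm (Fin (n + 1)))
    (p : Fin (m + 1) ⊕ Fin (n + 1) → C) (i : Fin (m + 1)) (j : Fin (n + 1)) :
    D.liftNum f (p ∘ Sum.map σ τ) i j = D.liftNum f p (σ i) (τ j) := by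
  obtain ⟨σ', hσ⟩ := exists_perm_succAbove σ i
  obtain ⟨τ', hτ⟩ := exists_perm_succAbove τ j
  have : del i j (p ∘ Sum.map σ τ) = del (σ i) (τ j) p ∘ Sum.map σ' τ' := by
    funext v
    rcases v with a | b
    · simp [del, hσ]
    · simp [del, hτ]
  rw [liftNum, liftNum, this, hf.2.1]
  congr 2
  · exact prod_comp_succAbove τ j fun l => D.z (p (Sum.inr l)) - D.z (p (Sum.inl (σ i)))
  · exact prod_comp_succAbove σ i fun l => D.z (p (Sum.inl l)) - D.z (p (Sum.inr (τ j)))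

/-- Swapping two equal coordinates does not change the point. This is the compatibility required by
`exists_divided_difference`. -/
theorem liftNum_eq_of_inl {f : (Fin m ⊕ Fin n → C) → k} (hf : f ∈ D.superReg m n)
    {p : Fin (m + 1) ⊕ Fin (n + 1) → C} {i i' : Fin (m + 1)} (j : Fin (n + 1))
    (h : p (Sum.inl i) = p (Sum.inl i')) : D.liftNum f p i j = D.liftNum f p i' j := by
  have := liftNum_comp hf (Equiv.swap i i') (Equiv.refl _) p i j
  rw [Equiv.swap_apply_left] at this
  rw [← Equiv.refl_apply (j : Fin (n + 1)), ← this, Equiv.refl_apply]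
  congr 1
  funext v
  rcases v with a | b
  · simp only [Function.comp_apply, Sum.map_inl, Equiv.swap_apply_def]
    split_ifs with h1 h2
    · rw [h1, h]
    · rw [h2, h]
    · rfl
  · rfl

theorem liftNum_eq_of_inr {f : (Fin m ⊕ Fin n → C) → k} (hf : f ∈ D.superReg m n)
    {p : Fin (m + 1) ⊕ Fin (n + 1) → C} (i : Fin (m + 1)) {j j' : Fin (n + 1)}
    (h : p (Sum.inr j) = p (Sum.inr j')) : D.liftNum f p i j = D.liftNum f p i j' := by
  have := liftNum_comp hf (Equiv.refl _) (Equiv.swap j j') p i j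
  rw [Equiv.swap_apply_left] at this
  rw [← Equiv.refl_apply (i : Fin (m + 1)), ← this, Equiv.refl_apply]
  congr 1
  funext v
  rcases v with a | b
  · rfl
  · simp only [Function.comp_apply, Sum.map_inr, Equiv.swap_apply_def]
    split_ifs with h1 h2
    · rw [h1, h]
    · rw [h2, h]
    · rfl

theorem liftSum_comp {f : (Fin m ⊕ Fin n → C) → k} (hf : f ∈ D.superReg m n)
    (σ : Equiv.Perm (Fin (m + 1))) (τ : Equiv.Perm (Fin (n + 1)))
    (p : Fin (m + 1) ⊕ Fin (n + 1) → C) :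
    D.liftSum f (p ∘ Sum.map σ τ) = D.liftSum f p := by
  unfold liftSum
  refine (Finset.sum_congr rfl fun j _ => ?_).trans (Equiv.sum_comp τ _)
  congr 1
  · refine (Finset.sum_congr rfl fun i _ => ?_).trans (Equiv.sum_comp σ _)
    rw [liftNum_comp hf]
    congr 2
    exact prod_comp_succAbove σ i fun l => D.z (p (Sum.inl l)) - D.z (p (Sum.inl (σ i)))
  · congr 1
    exact prod_comp_succAbove τ j fun l => D.z (p (Sum.inr l)) - D.z (p (Sum.inr (τ j)))

/-- The interpolation sum is a divided difference in the `y_j` of divided differences in the `x_i`,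
so its poles on the diagonals cancel. -/
theorem exists_reg_eq_liftSum {f : (Fin m ⊕ Fin n → C) → k} (hf : f ∈ D.superReg m n) :
    ∃ F ∈ D.reg (Fin (m + 1) ⊕ Fin (n + 1)), ∀ p, Function.Injective (p ∘ Sum.inl) →
      Function.Injective (p ∘ Sum.inr) → F p = D.liftSum f p := by
  classical
  have h1 : ∀ j : Fin (n + 1), ∃ h ∈ D.reg (Fin (m + 1) ⊕ Fin (n + 1)), ∀ p,
      Function.Injective (p ∘ Sum.inl) → h p = ∑ i, D.liftNum f p i j *
        (∏ l, (D.z (p (Sum.inl (i.succAbove l))) - D.z (p (Sum.inl i))))⁻¹ := fun j =>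
    exists_divided_difference m Sum.inl Sum.inl_injective (fun i p => D.liftNum f p i j)
      (fun i => liftNum_mem_reg hf.1 i j) fun i i' p hp => liftNum_eq_of_inl hf j hp
  choose h hh hh' using h1
  obtain ⟨F, hF, hF'⟩ := exists_divided_difference n Sum.inr Sum.inr_injective h hh (by
    intro j j' p hp
    by_cases hjj : j = j'
    · rw [hjj]
    -- The inner divided differences are given by the explicit sum only where the `x_i` are
    -- distinct. Substituting `y_j'` for `y_j` makes the locus `y_j = y_j'` a full space of regular
    -- functions, where density applies.
    have hz : (fun q : Fin (m + 1) ⊕ Fin (n + 1) → C =>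
        (h j - h j') (q ∘ Function.update id (Sum.inr j) (Sum.inr j'))) = 0 := by
      refine eq_zero_of_injective (rename_mem_reg _ ((D.reg _).sub_mem (hh j) (hh j')))
        fun q hq => ?_
      have hinj : Function.Injective
          ((q ∘ Function.update id (Sum.inr j) (Sum.inr j')) ∘ Sum.inl) := fun a b hab =>
        Sum.inl_injective (hq (by simpa using hab))
      rw [Pi.sub_apply, hh' j _ hinj, hh' j' _ hinj, sub_eq_zero]
      refine Finset.sum_congr rfl fun i _ => ?_
      rw [liftNum_eq_of_inr hf i (j := j) (j' := j')]
      simp [Function.update_of_ne (Sum.inr_injective.ne (Ne.symm hjj))]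
    have := congrFun hz p
    have hpp : p ∘ Function.update id (Sum.inr j) (Sum.inr j') = p := by
      funext v
      by_cases hv : v = Sum.inr j
      · subst hv; simp [hp]
      · simp [hv]
    rw [hpp] at this
    simpa [sub_eq_zero] using this)
  refine ⟨F, hF, fun p hp1 hp2 => ?_⟩
  rw [hF' p hp2, liftSum]
  exact Finset.sum_congr rfl fun j _ => by rw [hh' j p hp1]

theorem prod_sub_ne_zero {v : Fin (m + 1) → C} (hv : Function.Injective v) (i : Fin (m + 1)) :
    ∏ l, (D.z (v (i.succAbove l)) - D.z (v i)) ≠ 0 :=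
  Finset.prod_ne_zero_iff.2 fun l _ => sub_ne_zero.2 fun h =>
    Fin.succAbove_ne i l (hv (D.z_injective h))

end CoordData

/-! ### Surjectivity of the restriction. -/

namespace CoordData

variable {k C : Type*} [Field k] {D : CoordData k C} {m n : ℕ}

@[simp] theorem ext_inl (t : C) (p : Fin m ⊕ Fin n → C) :
    (ext t p) ∘ Sum.inl = Fin.cons t (p ∘ Sum.inl) := rfl
@[simp] theorem ext_inr (t : C) (p : Fin m ⊕ Fin n → C) :
    (ext t p) ∘ Sum.inr = Fin.cons t (p ∘ Sum.inr) := rfl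

/-- At `x_0 = y_0` the summand `(0, 0)` has equal numerator and denominator products and gives `f
p`. A summand with exactly one index 0 contains the factor `x_0 - y_0` up to sign and vanishes. -/
theorem liftSum_ext (f : (Fin m ⊕ Fin n → C) → k) (t : C) (p : Fin m ⊕ Fin n → C)
    (hx : Function.Injective (Fin.cons t (p ∘ Sum.inl) : Fin (m + 1) → C))
    (hy : Function.Injective (Fin.cons t (p ∘ Sum.inr) : Fin (n + 1) → C)) :
    D.liftSum f (ext t p) = f p + ∑ j : Fin n, (∑ i : Fin m, D.liftNum f (ext t p) i.succ j.succ *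
      (∏ l, (D.z (ext t p (Sum.inl (i.succ.succAbove l))) - D.z (p (Sum.inl i))))⁻¹) *
    (∏ l, (D.z (ext t p (Sum.inr (j.succ.succAbove l))) - D.z (p (Sum.inr j))))⁻¹ := by
  have hx0 := prod_sub_ne_zero (D := D) hx 0
  have hy0 := prod_sub_ne_zero (D := D) hy 0
  simp only [Fin.zero_succAbove, Fin.cons_succ, Fin.cons_zero, Function.comp_apply] at hx0 hy0
  have h00 : D.liftNum f (ext t p) 0 0 *
      (∏ l, (D.z (ext t p (Sum.inl (Fin.succAbove 0 l))) - D.z (ext t p (Sum.inl 0))))⁻¹ *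
      (∏ l, (D.z (ext t p (Sum.inr (Fin.succAbove 0 l))) - D.z (ext t p (Sum.inr 0))))⁻¹ =
      f p := by
    simp only [liftNum, Fin.zero_succAbove, ext_inl_zero, ext_inr_zero, ext_inl_succ,
      ext_inr_succ, del_zero_ext]
    field_simp
  have hi0 : ∀ i : Fin m, D.liftNum f (ext t p) i.succ 0 = 0 := fun i => by
    have : ∏ l, (D.z (ext t p (Sum.inl (i.succ.succAbove l))) - D.z (ext t p (Sum.inr 0))) = 0 :=
      Finset.prod_eq_zero (i := ⟨0, i.pos⟩) (Finset.mem_univ _) (by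
        have : NeZero m := ⟨i.pos.ne'⟩
        rw [show (⟨0, i.pos⟩ : Fin m) = 0 from rfl, Fin.succ_succAbove_zero]; simp)
    rw [liftNum, this]; simp
  have h0j : ∀ j : Fin n, D.liftNum f (ext t p) 0 j.succ = 0 := fun j => by
    have : ∏ l, (D.z (ext t p (Sum.inr (j.succ.succAbove l))) - D.z (ext t p (Sum.inl 0))) = 0 :=
      Finset.prod_eq_zero (i := ⟨0, j.pos⟩) (Finset.mem_univ _) (by
        have : NeZero n := ⟨j.pos.ne'⟩
        rw [show (⟨0, j.pos⟩ : Fin n) = 0 from rfl, Fin.succ_succAbove_zero]; simp)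
    rw [liftNum, this]; simp
  rw [liftSum, Fin.sum_univ_succ]
  congr 1
  · rw [Fin.sum_univ_succ]
    simp only [hi0, zero_mul, Finset.sum_const_zero, add_zero]
    exact h00
  · refine Finset.sum_congr rfl fun j _ => ?_
    rw [Fin.sum_univ_succ, h0j, zero_mul, zero_add]
    rfl

theorem liftSum_ext_of_eq_zero (h : m = 0 ∨ n = 0) (f : (Fin m ⊕ Fin n → C) → k) (t : C)
    (p : Fin m ⊕ Fin n → C)
    (hx : Function.Injective (Fin.cons t (p ∘ Sum.inl) : Fin (m + 1) → C))
    (hy : Function.Injective (Fin.cons t (p ∘ Sum.inr) : Fin (n + 1) → C)) :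
    D.liftSum f (ext t p) = f p := by
  rw [liftSum_ext f t p hx hy]
  rcases h with rfl | rfl <;> simp

/-- In the summands with both indices nonzero, the factors `t - x_i` and `t - y_j` of the numerator
cancel against the same factors of the denominators, leaving the interpolation sum of `res f`. -/
theorem liftSum_ext_succ (f : D.superReg (m + 1) (n + 1)) (t : C)
    (p : Fin (m + 1) ⊕ Fin (n + 1) → C)
    (hx : Function.Injective (Fin.cons t (p ∘ Sum.inl) : Fin (m + 2) → C))
    (hy : Function.Injective (Fin.cons t (p ∘ Sum.inr) : Fin (n + 2) → C)) :
    D.liftSum f.1 (ext t p) = f.1 p + D.liftSum (D.res m n f).1 p := by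
  rw [liftSum_ext f.1 t p hx hy]
  congr 1
  refine Finset.sum_congr rfl fun j _ => ?_
  rw [Finset.sum_mul, Finset.sum_mul]
  refine Finset.sum_congr rfl fun i _ => ?_
  have hi : D.z t - D.z (p (Sum.inl i)) ≠ 0 := sub_ne_zero.2 fun h =>
    Fin.succ_ne_zero i (hx (by simpa using (D.z_injective h).symm))
  have hj : D.z t - D.z (p (Sum.inr j)) ≠ 0 := sub_ne_zero.2 fun h =>
    Fin.succ_ne_zero j (hy (by simpa using (D.z_injective h).symm))
  simp only [liftNum, del_succ_ext, res_apply _ _ t, Fin.prod_univ_succ (n := m),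
    Fin.prod_univ_succ (n := n), Fin.succ_succAbove_zero, Fin.succ_succAbove_succ, ext_inl_zero,
    ext_inr_zero, ext_inl_succ, ext_inr_succ, mul_inv]
  field_simp

theorem exists_lift (f : D.superReg m n) : ∃ F : D.superReg (m + 1) (n + 1),
    (∀ p, Function.Injective (p ∘ Sum.inl) → Function.Injective (p ∘ Sum.inr) →
      F.1 p = D.liftSum f.1 p) := by
  obtain ⟨F, hF, hF'⟩ := exists_reg_eq_liftSum f.2
  have hinv : ∀ (σ : Equiv.Perm (Fin (m + 1))) (τ : Equiv.Perm (Fin (n + 1))) p,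
      F (p ∘ Sum.map σ τ) = F p := fun σ τ p =>
    congrFun (eq_of_injective (rename_mem_reg _ hF) hF fun p hp => by
      rw [hF' p (hp.comp Sum.inl_injective) (hp.comp Sum.inr_injective),
        hF' (p ∘ Sum.map σ τ) ((hp.comp Sum.inl_injective).comp σ.injective)
          ((hp.comp Sum.inr_injective).comp τ.injective), liftSum_comp f.2]) p
  have hG : ∃ G ∈ D.reg (Fin m ⊕ Fin n), ∀ t p,
      Function.Injective (Fin.cons t (p ∘ Sum.inl) : Fin (m + 1) → C) →
      Function.Injective (Fin.cons t (p ∘ Sum.inr) : Fin (n + 1) → C) →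
      D.liftSum f.1 (ext t p) = G p := by
    rcases m with _ | m
    · exact ⟨f.1, f.2.1, fun t p => liftSum_ext_of_eq_zero (Or.inl rfl) _ t p⟩
    rcases n with _ | n
    · exact ⟨f.1, f.2.1, fun t p => liftSum_ext_of_eq_zero (Or.inr rfl) _ t p⟩
    obtain ⟨G, hG, hG'⟩ := exists_reg_eq_liftSum (D.res m n f).2
    refine ⟨f.1 + G, (D.reg _).add_mem f.2.1 hG, fun t p hx hy => ?_⟩
    rw [liftSum_ext_succ f t p hx hy, Pi.add_apply, hG' p]
    · exact (Fin.cons_injective_iff.1 hx).2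
    · exact (Fin.cons_injective_iff.1 hy).2
  obtain ⟨G, hG, hG'⟩ := hG
  -- The inserted value is made an extra coordinate `none`, so that density extends the identity
  -- from distinct coordinates to all `t` and `p`.
  have hext : ∀ t p, F (ext t p) = G p := fun t p => by
    have := congrFun (eq_of_injective (ι := Option (Fin m ⊕ Fin n)) (D := D) (ext_mem_reg hF)
      (rename_mem_reg some hG) fun q hq => ?_) (fun v => v.elim t p)
    · exact this
    · have h1 : Function.Injective
          (Fin.cons (q none) ((q ∘ some) ∘ Sum.inl) : Fin (m + 1) → C) :=
        Fin.cons_injective_iff.2 ⟨fun ⟨i, hi⟩ => by simpa using hq hi,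
          hq.comp ((Option.some_injective _).comp Sum.inl_injective)⟩
      have h2 : Function.Injective
          (Fin.cons (q none) ((q ∘ some) ∘ Sum.inr) : Fin (n + 1) → C) :=
        Fin.cons_injective_iff.2 ⟨fun ⟨i, hi⟩ => by simpa using hq hi,
          hq.comp ((Option.some_injective _).comp Sum.inr_injective)⟩
      rw [hF' (ext (q none) (q ∘ some)) h1 h2, hG' _ _ h1 h2]
  exact ⟨⟨F, mem_superReg_of_ext hF hinv fun s t p => by rw [hext, hext]⟩, hF'⟩

/-- The lift of a supersymmetric function to one pair of variables more. -/
def lift (f : D.superReg m n) : D.superReg (m + 1) (n + 1) :=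
  (exists_lift f).choose

theorem lift_apply (f : D.superReg m n) {p : Fin (m + 1) ⊕ Fin (n + 1) → C}
    (h1 : Function.Injective (p ∘ Sum.inl)) (h2 : Function.Injective (p ∘ Sum.inr)) :
    (lift f).1 p = D.liftSum f.1 p :=
  (exists_lift f).choose_spec p h1 h2

/-- A dummy coordinate supplies a value `t` different from all coordinates of the test point, as the
formulas for `liftSum` at `ext t p` require. -/
theorem eq_of_forall_ext_eq {f g : (Fin m ⊕ Fin n → C) → k} (hf : f ∈ D.reg _) (hg : g ∈ D.reg _)
    (h : ∀ t p, Function.Injective (Fin.cons t (p ∘ Sum.inl) : Fin (m + 1) → C) →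
      Function.Injective (Fin.cons t (p ∘ Sum.inr) : Fin (n + 1) → C) → f p = g p) : f = g := by
  funext p
  have := congrFun (eq_of_injective (ι := Option (Fin m ⊕ Fin n)) (D := D)
    (rename_mem_reg some hf) (rename_mem_reg some hg) fun q hq => h (q none) (q ∘ some) ?_ ?_)
    (fun v => v.elim D.base p)
  · exact this
  · exact Fin.cons_injective_iff.2 ⟨fun ⟨i, hi⟩ => by simpa using hq hi,
      hq.comp ((Option.some_injective _).comp Sum.inl_injective)⟩
  · exact Fin.cons_injective_iff.2 ⟨fun ⟨i, hi⟩ => by simpa using hq hi,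
      hq.comp ((Option.some_injective _).comp Sum.inr_injective)⟩

theorem res_lift_of_eq_zero (h : m = 0 ∨ n = 0) (f : D.superReg m n) :
    D.res m n (lift f) = f :=
  Subtype.ext (eq_of_forall_ext_eq (D.res m n (lift f)).2.1 f.2.1 fun t p hx hy => by
    rw [res_apply _ p t, lift_apply f (p := ext t p) hx hy, liftSum_ext_of_eq_zero h _ _ _ hx hy])

theorem res_lift_succ (f : D.superReg (m + 1) (n + 1)) :
    D.res (m + 1) (n + 1) (lift f) = f + lift (D.res m n f) :=
  Subtype.ext (eq_of_forall_ext_eq (D.res _ _ (lift f)).2.1 (f + lift (D.res m n f)).2.1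
    fun t p hx hy => by
      rw [res_apply _ p t, lift_apply f (p := ext t p) hx hy, liftSum_ext_succ f _ _ hx hy]
      change _ = f.1 p + (lift (D.res m n f)).1 p
      rw [lift_apply _ (Fin.cons_injective_iff.1 hx).2 (Fin.cons_injective_iff.1 hy).2])

theorem add_one_smul {M : Type*} [AddCommGroup M] [Module k M] (a : k) (u : M) :
    (a + 1) • u = a • u + u := by
  rw [add_smul, one_smul]

/-- Surjectivity is the case `c = 0`; the parameter lets the induction run. By `res_lift_succ` the
equation reads `(c + 1) u + lift (res u) = g`, and applying `res` gives for `w = res u` the same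
equation with `c + 1` in place of `c`. -/
theorem exists_smul_add_res_lift [CharZero k] (m n : ℕ) (c : ℕ) (g : D.superReg m n) :
    ∃ u : D.superReg m n, (c : k) • u + D.res m n (lift u) = g := by
  have hbase : ∀ {m n : ℕ}, m = 0 ∨ n = 0 → ∀ (c : ℕ) (g : D.superReg m n),
      ∃ u : D.superReg m n, (c : k) • u + D.res m n (lift u) = g := fun h c g => by
    have hc : ((c : k) + 1) ≠ 0 := Nat.cast_add_one_ne_zero c
    refine ⟨((c : k) + 1)⁻¹ • g, ?_⟩
    rw [res_lift_of_eq_zero h, ← add_one_smul, smul_smul, mul_inv_cancel₀ hc, one_smul]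
  induction m generalizing n c with
  | zero => exact hbase (Or.inl rfl) c g
  | succ m ih =>
    rcases n with _ | n
    · exact hbase (Or.inr rfl) c g
    have hc : ((c : k) + 1) ≠ 0 := Nat.cast_add_one_ne_zero c
    obtain ⟨w, hw⟩ := ih n (c + 1) (D.res m n g)
    refine ⟨((c : k) + 1)⁻¹ • (g - lift w), ?_⟩
    -- The candidate `u` was built from `w`; its restriction has to be `w` for the equation to close
    -- up.
    have : D.res m n (((c : k) + 1)⁻¹ • (g - lift w)) = w := by
      rw [map_smul, map_sub, ← hw, add_sub_cancel_right, smul_smul, Nat.cast_add_one,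
        inv_mul_cancel₀ hc, one_smul]
    rw [res_lift_succ, this, ← add_assoc, ← add_one_smul, smul_smul, mul_inv_cancel₀ hc, one_smul,
      sub_add_cancel]

theorem res_surjective [CharZero k] (m n : ℕ) : Function.Surjective (D.res m n) := fun g => by
  obtain ⟨u, hu⟩ := exists_smul_add_res_lift m n 0 g
  exact ⟨lift u, by simpa using hu⟩

end CoordData

/-! ### The strong Nullstellensatz. -/

namespace CoordData

variable {k C : Type*} [Field k] {D : CoordData k C} {m n : ℕ}

theorem exists_point_reg {ι : Type*} (χ : D.reg ι →ₐ[k] k) :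
    ∃ p : ι → C, ∀ f : D.reg ι, χ f = f.1 p := by
  have h : ∀ v : ι, ∃ c, ∀ φ (hφ : φ ∈ D.gens), χ ⟨_, gen_mem_reg hφ v⟩ = φ c := fun v => by
    let ψ : Algebra.adjoin k D.gens →ₐ[k] D.reg ι :=
      ((compHom fun p : ι → C => p v).comp (Algebra.adjoin k D.gens).val).codRestrict (D.reg ι)
        fun a => adjoin_comp_mem_reg a.2 v
    exact D.exists_point (χ.comp ψ)
  choose p hp using h
  refine ⟨p, fun f => ?_⟩
  obtain ⟨f, hf⟩ := f
  induction hf using Algebra.adjoin_induction with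
  | mem f hf =>
    obtain ⟨φ, hφ, v, rfl⟩ := hf
    exact hp v φ hφ
  | algebraMap c => exact χ.commutes c
  | add f g hf hg h1 h2 =>
    exact (map_add χ ⟨f, hf⟩ ⟨g, hg⟩).trans (congrArg₂ (· + ·) h1 h2)
  | mul f g hf hg h1 h2 =>
    exact (map_mul χ ⟨f, hf⟩ ⟨g, hg⟩).trans (congrArg₂ (· * ·) h1 h2)

instance finiteType_reg {ι : Type*} [Finite ι] : Algebra.FiniteType k (D.reg ι) := by
  refine (Subalgebra.fg_iff_finiteType _).1 (Subalgebra.fg_def.2 ⟨_, ?_, rfl⟩)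
  have := D.finite_gens
  refine (Set.Finite.image2 (fun φ v => fun p : ι → C => φ (p v)) this Set.finite_univ).subset ?_
  rintro _ ⟨φ, hφ, v, rfl⟩
  exact ⟨φ, hφ, v, trivial, rfl⟩

/-- Hilbert's Nullstellensatz for an algebra of finite type, with closed points given by
homomorphisms to the field. -/
theorem mem_radical_of_forall_algHom {B : Type*} [CommRing B] [Algebra k B] [IsAlgClosed k]
    [Algebra.FiniteType k B] (I : Ideal B) (f : B)
    (h : ∀ χ : B →ₐ[k] k, (∀ g ∈ I, χ g = 0) → χ f = 0) : f ∈ I.radical := by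
  have : IsJacobsonRing B := isJacobsonRing_of_finiteType (A := k)
  rw [Ideal.radical_eq_jacobson, Ideal.jacobson, Ideal.mem_sInf]
  rintro M ⟨hIM, hM⟩
  let := Ideal.Quotient.field M
  have : Module.Finite k (B ⧸ M) := finite_of_finite_type_of_isJacobsonRing k (B ⧸ M)
  have hb := IsAlgClosed.algebraMap_bijective_of_isIntegral (k := k) (K := B ⧸ M)
  let e : k ≃ₐ[k] (B ⧸ M) := AlgEquiv.ofBijective (Algebra.ofId k _) hb
  have := h ((e.symm : (B ⧸ M) →ₐ[k] k).comp (Ideal.Quotient.mkₐ k M)) fun g hg => by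
    have : Ideal.Quotient.mkₐ k M g = 0 := Ideal.Quotient.eq_zero_iff_mem.2 (hIM hg)
    exact (congrArg e.symm this).trans (map_zero _)
  exact Ideal.Quotient.eq_zero_iff_mem.1 ((map_eq_zero_iff e.symm e.symm.injective).1 this)

theorem comp_sumMap_mem_reg (σ : Equiv.Perm (Fin m)) (τ : Equiv.Perm (Fin n))
    {f : (Fin m ⊕ Fin n → C) → k} (hf : f ∈ D.reg _) :
    (fun p => f (p ∘ Sum.map σ τ)) ∈ D.reg _ :=
  rename_mem_reg _ hf

/-- The sum of the translates of a function under the permutations of the coordinates. -/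
def permSum (f : (Fin m ⊕ Fin n → C) → k) (p : Fin m ⊕ Fin n → C) : k :=
  ∑ s : Equiv.Perm (Fin m) × Equiv.Perm (Fin n), f (p ∘ Sum.map s.1 s.2)

theorem permSum_mem_reg {f : (Fin m ⊕ Fin n → C) → k} (hf : f ∈ D.reg _) :
    permSum f ∈ D.reg _ := by
  convert (D.reg (Fin m ⊕ Fin n)).sum_mem (t := Finset.univ)
    fun (s : Equiv.Perm (Fin m) × Equiv.Perm (Fin n)) _ => comp_sumMap_mem_reg s.1 s.2 hf using 1
  funext p
  simp [permSum]

theorem permSum_comp (f : (Fin m ⊕ Fin n → C) → k) (σ : Equiv.Perm (Fin m))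
    (τ : Equiv.Perm (Fin n)) (p : Fin m ⊕ Fin n → C) :
    permSum f (p ∘ Sum.map σ τ) = permSum f p := by
  unfold permSum
  refine Eq.trans ?_ (Equiv.sum_comp (Equiv.mulLeft (σ, τ)) _)
  refine Finset.sum_congr rfl fun s _ => congrArg f ?_
  funext v
  rcases v with a | b <;> simp

/-- Vanishing on all loci `x_i = y_j` makes the independence condition automatic, so only symmetry
of the second factor matters. -/
theorem mul_permSum_mem {j : (Fin m ⊕ Fin n → C) → k} (hj : j ∈ D.superReg m n)
    (hj0 : ∀ p a b, p (Sum.inl a) = p (Sum.inr b) → j p = 0) {f : (Fin m ⊕ Fin n → C) → k}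
    (hf : f ∈ D.reg _) : j * permSum f ∈ D.superReg m n :=
  ⟨(D.reg _).mul_mem hj.1 (permSum_mem_reg hf),
    fun σ τ p => by rw [Pi.mul_apply, hj.2.1, permSum_comp, Pi.mul_apply],
    fun a b p q hp hq _ => by rw [Pi.mul_apply, Pi.mul_apply, hj0 p a b hp, hj0 q a b hq,
      zero_mul, zero_mul]⟩

variable (D) in
/-- The inclusion of the supersymmetric functions into all regular functions. -/
def incl (m n : ℕ) : D.superReg m n →ₐ[k] D.reg (Fin m ⊕ Fin n) :=
  Subalgebra.inclusion fun _ h => h.1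

/-- Summation over the group is linear over invariants: `j * permSum (c * g) = (j * permSum c) * g`
for `g ∈ I`, and `j * permSum c` is supersymmetric. -/
theorem mul_permSum_mem_ideal (I : Ideal (D.superReg m n)) {j : (Fin m ⊕ Fin n → C) → k}
    (hj : j ∈ D.superReg m n) (hj0 : ∀ p a b, p (Sum.inl a) = p (Sum.inr b) → j p = 0)
    (x : D.reg (Fin m ⊕ Fin n)) (hx : x ∈ I.map (D.incl m n)) :
    (⟨_, mul_permSum_mem hj hj0 x.2⟩ : D.superReg m n) ∈ I := by
  -- The extra factor `c` absorbs the coefficients in the induction over the span.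
  suffices h : ∀ c : D.reg (Fin m ⊕ Fin n),
      (⟨_, mul_permSum_mem hj hj0 (c * x).2⟩ : D.superReg m n) ∈ I by
    simpa using h 1
  induction hx using Submodule.span_induction with
  | mem x hx =>
    obtain ⟨g, hg, rfl⟩ := hx
    intro c
    have : (⟨_, mul_permSum_mem hj hj0 (c * D.incl m n g).2⟩ : D.superReg m n) =
        ⟨_, mul_permSum_mem hj hj0 c.2⟩ * g := by
      ext p
      change j p * ∑ s : Equiv.Perm (Fin m) × Equiv.Perm (Fin n),
        c.1 (p ∘ Sum.map s.1 s.2) * g.1 (p ∘ Sum.map s.1 s.2) = j p * permSum c.1 p * g.1 p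
      simp only [g.2.2.1, ← Finset.sum_mul]
      rw [mul_assoc]
      rfl
    rw [this]
    exact I.mul_mem_left _ hg
  | zero =>
    intro c
    convert I.zero_mem using 1
    ext p
    change j p * ∑ s : Equiv.Perm (Fin m) × Equiv.Perm (Fin n), c.1 (p ∘ Sum.map s.1 s.2) * 0 = 0
    simp
  | add x y _ _ h1 h2 =>
    intro c
    convert I.add_mem (h1 c) (h2 c) using 1
    ext p
    change j p * ∑ s : Equiv.Perm (Fin m) × Equiv.Perm (Fin n), c.1 (p ∘ Sum.map s.1 s.2) *
      (x.1 (p ∘ Sum.map s.1 s.2) + y.1 (p ∘ Sum.map s.1 s.2)) =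
        j p * permSum (c * x).1 p + j p * permSum (c * y).1 p
    simp only [mul_add, Finset.sum_add_distrib]
    rfl
  | smul a x _ h =>
    intro c
    convert h (c * a) using 2
    rw [smul_eq_mul, mul_assoc]

/-- The classical Nullstellensatz in the finitely generated algebra of regular functions, followed
by averaging; `f ^ N` is invariant, so averaging returns it. -/
theorem exists_mul_pow_mem [IsAlgClosed k] [CharZero k] (I : Ideal (D.superReg m n))
    (f : D.superReg m n) (h : ∀ p, (∀ g ∈ I, g.1 p = 0) → f.1 p = 0) :
    ∃ N : ℕ, ∀ j : D.superReg m n, (∀ p a b, p (Sum.inl a) = p (Sum.inr b) → j.1 p = 0) →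
      j * f ^ N ∈ I := by
  have hr : D.incl m n f ∈ (I.map (D.incl m n)).radical := by
    refine mem_radical_of_forall_algHom (k := k) _ _ fun χ hχ => ?_
    obtain ⟨p, hp⟩ := exists_point_reg χ
    rw [hp]
    exact h p fun g hg => (hp (D.incl m n g)).symm.trans (hχ _ (Ideal.mem_map_of_mem _ hg))
  obtain ⟨N, hN⟩ := hr
  refine ⟨N, fun j hj => ?_⟩
  have hmem := mul_permSum_mem_ideal I j.2 hj _ hN
  set c : k := (Fintype.card (Equiv.Perm (Fin m) × Equiv.Perm (Fin n)) : k) with hc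
  have hc0 : c ≠ 0 := Nat.cast_ne_zero.2 Fintype.card_ne_zero
  have : j * f ^ N = algebraMap k (D.superReg m n) c⁻¹ *
      ⟨_, mul_permSum_mem j.2 hj (D.incl m n f ^ N).2⟩ := by
    ext p
    change j.1 p * f.1 p ^ N = c⁻¹ * (j.1 p * ∑ s : Equiv.Perm (Fin m) × Equiv.Perm (Fin n),
      f.1 (p ∘ Sum.map s.1 s.2) ^ N)
    simp only [f.2.2.1, Finset.sum_const, nsmul_eq_mul, Finset.card_univ, ← hc]
    field_simp
  rw [this]
  exact I.mul_mem_left _ hmem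

/-- The strong Nullstellensatz for supersymmetric functions. -/
theorem mem_radical_of_forall [IsAlgClosed k] [CharZero k] (m n : ℕ) (I : Ideal (D.superReg m n))
    (f : D.superReg m n) (h : ∀ p, (∀ g ∈ I, g.1 p = 0) → f.1 p = 0) : f ∈ I.radical := by
  have hbase : ∀ {m n : ℕ}, m = 0 ∨ n = 0 → ∀ (I : Ideal (D.superReg m n))
      (f : D.superReg m n), (∀ p, (∀ g ∈ I, g.1 p = 0) → f.1 p = 0) → f ∈ I.radical := by
    intro m n hmn I f h
    obtain ⟨N, hN⟩ := exists_mul_pow_mem I f h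
    refine ⟨N, ?_⟩
    -- Without variables of one kind there are no loci `x_i = y_j`, so `j = 1` is allowed.
    have := hN 1 fun p a b _ => by
      rcases hmn with rfl | rfl
      · exact a.elim0
      · exact b.elim0
    rwa [one_mul] at this
  induction m generalizing n with
  | zero => exact hbase (Or.inl rfl) I f h
  | succ m ih =>
    rcases n with _ | n
    · exact hbase (Or.inr rfl) I f h
    obtain ⟨N, hN⟩ := exists_mul_pow_mem I f h
    obtain ⟨M, hM⟩ := ih n (I.map (D.res m n)) (D.res m n f) fun p hp =>
      h (ext D.base p) fun g hg => hp _ (Ideal.mem_map_of_mem _ hg)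
    obtain ⟨g, hg, hgf⟩ := (Ideal.mem_map_iff_of_surjective _ (res_surjective m n)).1 hM
    have := hN (f ^ M - g) ((res_eq_zero_iff _).1 (by rw [map_sub, map_pow, hgf, sub_self]))
    refine ⟨M + N, ?_⟩
    rw [show f ^ (M + N) = (f ^ M - g) * f ^ N + f ^ N * g by ring]
    exact I.add_mem this (I.mul_mem_left _ hg)

/-! ### Failure of the Noetherian property. -/

/-- The product of all `x_i - y_j`. -/
def resultant (D : CoordData k C) (p : Fin m ⊕ Fin n → C) : k :=
  ∏ i, ∏ j, (D.z (p (Sum.inl i)) - D.z (p (Sum.inr j)))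

/-- The sum of the `x_i`. -/
def sumInl (D : CoordData k C) (p : Fin m ⊕ Fin n → C) : k :=
  ∑ i, D.z (p (Sum.inl i))

theorem sumInl_mem_reg : sumInl D ∈ D.reg (Fin m ⊕ Fin n) := by
  convert (D.reg (Fin m ⊕ Fin n)).sum_mem (t := Finset.univ) fun i _ => z_mem_reg (Sum.inl i)
    using 1
  funext p
  simp [sumInl]

theorem resultant_mem_reg : resultant D ∈ D.reg (Fin m ⊕ Fin n) := by
  convert (D.reg (Fin m ⊕ Fin n)).prod_mem (t := Finset.univ) fun i _ =>
    (D.reg (Fin m ⊕ Fin n)).prod_mem (t := Finset.univ) fun j _ =>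
      sub_mem_reg (D := D) (Sum.inl i) (Sum.inr j) using 1
  funext p
  simp [resultant]

theorem resultant_eq_zero {p : Fin m ⊕ Fin n → C} {i : Fin m} {j : Fin n}
    (h : p (Sum.inl i) = p (Sum.inr j)) : resultant D p = 0 :=
  Finset.prod_eq_zero (Finset.mem_univ i)
    (Finset.prod_eq_zero (Finset.mem_univ j) (by rw [h, sub_self]))

theorem resultant_ne_zero {p : Fin m ⊕ Fin n → C} (h : Function.Injective p) :
    resultant D p ≠ 0 :=
  Finset.prod_ne_zero_iff.2 fun _ _ => Finset.prod_ne_zero_iff.2 fun _ _ =>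
    sub_ne_zero.2 fun hz => Sum.inl_ne_inr (h (D.z_injective hz))

theorem resultant_comp (σ : Equiv.Perm (Fin m)) (τ : Equiv.Perm (Fin n))
    (p : Fin m ⊕ Fin n → C) : resultant D (p ∘ Sum.map σ τ) = resultant D p :=
  (Finset.prod_congr rfl fun i _ => Equiv.prod_comp τ fun j =>
    D.z (p (Sum.inl (σ i))) - D.z (p (Sum.inr j))).trans
    (Equiv.prod_comp σ fun i => ∏ j, (D.z (p (Sum.inl i)) - D.z (p (Sum.inr j))))

theorem sumInl_comp (σ : Equiv.Perm (Fin m)) (τ : Equiv.Perm (Fin n))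
    (p : Fin m ⊕ Fin n → C) : sumInl D (p ∘ Sum.map σ τ) = sumInl D p :=
  Equiv.sum_comp σ fun i => D.z (p (Sum.inl i))

theorem resultant_mul_pow_mem (N : ℕ) :
    (resultant D * sumInl D ^ N : (Fin m ⊕ Fin n → C) → k) ∈ D.superReg m n :=
  ⟨(D.reg _).mul_mem resultant_mem_reg ((D.reg _).pow_mem sumInl_mem_reg N),
    fun σ τ p => by simp only [Pi.mul_apply, Pi.pow_apply, resultant_comp, sumInl_comp],
    fun i j p q hp hq _ => by
      simp only [Pi.mul_apply, resultant_eq_zero hp, resultant_eq_zero hq, zero_mul]⟩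

theorem not_isNoetherianRing_superReg [Infinite C] (m n : ℕ) :
    ¬ IsNoetherianRing (D.superReg (m + 1) (n + 1)) := by
  intro hN
  let a : ℕ → D.superReg (m + 1) (n + 1) := fun i => ⟨_, resultant_mul_pow_mem i⟩
  obtain ⟨N, hN⟩ := monotone_stabilizes_iff_noetherian.2 hN
    ⟨fun N => Ideal.span (a '' Set.Iio N), fun M N h =>
      Ideal.span_mono (Set.image_mono (Set.Iio_subset_Iio h))⟩
  have hmem : a N ∈ Ideal.span (a '' Set.Iio N) := by
    have : Ideal.span (a '' Set.Iio N) = Ideal.span (a '' Set.Iio (N + 1)) :=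
      hN (N + 1) (Nat.le_succ N)
    rw [this]
    exact Ideal.subset_span ⟨N, Nat.lt_succ_self N, rfl⟩
  have hrange : a '' Set.Iio N = Set.range fun i : Fin N => a i := by
    ext x
    constructor
    · rintro ⟨i, hi, rfl⟩
      exact ⟨⟨i, hi⟩, rfl⟩
    · rintro ⟨i, rfl⟩
      exact ⟨i, i.2, rfl⟩
  rw [hrange, Ideal.mem_span_range_iff_exists_fun] at hmem
  obtain ⟨c, hc⟩ := hmem
  have hc' : ∀ p, ∑ i, (c i).1 p * (resultant D p * sumInl D p ^ (i : ℕ)) =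
      resultant D p * sumInl D p ^ N := fun p => by
    have := congrArg (fun f : D.superReg (m + 1) (n + 1) => f.1 p) hc
    simpa [a] using this
  -- The resultant is cancelled where it is nonzero, at points with distinct coordinates; density
  -- gives the rest.
  have hmonic : (fun p => sumInl D p ^ N) = fun p => ∑ i, (c i).1 p * sumInl D p ^ (i : ℕ) := by
    refine eq_of_injective (D := D) ((D.reg _).pow_mem sumInl_mem_reg N) ?_ fun p hp => ?_
    · convert (D.reg (Fin (m + 1) ⊕ Fin (n + 1))).sum_mem (t := Finset.univ) fun (i : Fin N) _ =>
        (D.reg _).mul_mem (c i).2.1 ((D.reg _).pow_mem sumInl_mem_reg (i : ℕ)) using 1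
      funext p
      simp
    · refine mul_left_cancel₀ (resultant_ne_zero (D := D) hp) ?_
      rw [← hc', Finset.mul_sum]
      exact Finset.sum_congr rfl fun i _ => by ring
  let q : Fin m ⊕ Fin n → C := fun _ => D.base
  -- The monic relation along the line `x_0 = y_0 = t` with all other coordinates at the base point:
  -- its coefficients do not depend on `t`, and every value of `sumInl D` there is a root.
  let P : Polynomial k := Polynomial.X ^ N - ∑ i : Fin N,
    Polynomial.C ((D.res m n (c i)).1 q) * Polynomial.X ^ (i : ℕ)
  have hP0 : P ≠ 0 := fun h => by
    have := congrArg (Polynomial.coeff · N) h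
    simp only [P, Polynomial.coeff_sub, Polynomial.finsetSum_coeff, Polynomial.coeff_C_mul,
      Polynomial.coeff_X_pow, Polynomial.coeff_zero] at this
    rw [Finset.sum_eq_zero fun i _ => by simp [i.2.ne']] at this
    simp at this
  refine hP0 (Polynomial.eq_zero_of_infinite_isRoot P ((Set.infinite_range_of_injective
    (f := fun t : C => sumInl D (ext t q)) fun s t hst => ?_).mono ?_))
  · simp only [sumInl, Fin.sum_univ_succ, ext_inl_zero, ext_inl_succ, add_left_inj] at hst
    exact D.z_injective hst
  · rintro _ ⟨t, rfl⟩
    have := congrFun hmonic (ext t q)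
    simp only [← res_apply _ q t] at this
    simp [P, Polynomial.IsRoot, Polynomial.eval_finsetSum, this]

end CoordData

/-! ### Formal consequences, and transport to concrete algebras. -/

/-- The correspondence between closed sets and radical ideals that follows from the strong
Nullstellensatz. -/
theorem correspondence {k A X : Type*} [Field k] [CommRing A] [Algebra k A] (ev : X → A →ₐ[k] k)
    (h : ∀ (I : Ideal A) f, (∀ p, (∀ g ∈ I, ev p g = 0) → ev p f = 0) → f ∈ I.radical) :
    Set.BijOn (vanishing ev) {V | IsSuperalgebraic ev V} {I : Ideal A | I.IsRadical} ∧
    Set.BijOn (fun I : Ideal A => zeros ev (I : Set A)) {I : Ideal A | I.IsRadical}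
      {V | IsSuperalgebraic ev V} ∧
    Set.InvOn (fun I : Ideal A => zeros ev (I : Set A)) (vanishing ev)
      {V | IsSuperalgebraic ev V} {I : Ideal A | I.IsRadical} ∧
    Antitone (vanishing ev) ∧ Antitone (fun I : Ideal A => zeros ev (I : Set A)) := by
  have hinv : Set.InvOn (fun I : Ideal A => zeros ev (I : Set A)) (vanishing ev)
      {V | IsSuperalgebraic ev V} {I : Ideal A | I.IsRadical} := by
    refine ⟨?_, fun I hI => le_antisymm (fun f hf => hI (h I f hf)) fun f hf p hp => hp f hf⟩
    rintro _ ⟨E, rfl⟩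
    exact Set.Subset.antisymm (fun p hp f hf => hp f fun q hq => hq f hf)
      fun p hp f hf => hf p hp
  have h1 : Set.MapsTo (vanishing ev) {V | IsSuperalgebraic ev V} {I : Ideal A | I.IsRadical} := by
    rintro V - f ⟨N, hN⟩ p hp
    have := hN p hp
    rw [map_pow] at this
    exact IsReduced.eq_zero _ ⟨N, this⟩
  have h2 : Set.MapsTo (fun I : Ideal A => zeros ev (I : Set A)) {I : Ideal A | I.IsRadical}
      {V | IsSuperalgebraic ev V} := fun I _ => ⟨I, rfl⟩
  exact ⟨hinv.bijOn h1 h2, hinv.symm.bijOn h2 h1, hinv,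
    fun V V' hV f hf p hp => hf p (hV hp), fun I J hIJ p hp f hf => hp f (hIJ hf)⟩

namespace CoordData

variable {k C : Type*} [Field k] {D : CoordData k C} {m n : ℕ}

/-- The equivalence of a subalgebra with the supersymmetric functions that is induced by a
faithful realization of the ambient algebra by functions. -/
def equivOfRealization {R : Type*} [CommRing R] [Algebra k R] (S : Subalgebra k R)
    (Φ : R →ₐ[k] ((Fin m ⊕ Fin n → C) → k)) (hinj : Function.Injective Φ)
    (hS : ∀ f, f ∈ S ↔ Φ f ∈ D.superReg m n) (hrange : D.reg _ ≤ Φ.range) :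
    S ≃ₐ[k] D.superReg m n :=
  AlgEquiv.ofBijective ((Φ.comp S.val).codRestrict (D.superReg m n) fun f => (hS f).1 f.2)
    ⟨fun f g h => Subtype.ext (hinj (congrArg Subtype.val h)), fun g => by
      obtain ⟨f, hf⟩ := hrange g.2.1
      exact ⟨⟨f, (hS f).2 (by rw [show Φ f = g.1 from hf]; exact g.2)⟩, Subtype.ext hf⟩⟩

/-- The ideal is carried to the function model; `hev` turns each point there into a point of `X`
with the same values. -/
theorem nullstellensatz_of_realization [IsAlgClosed k] [CharZero k] {R : Type*} [CommRing R]
    [Algebra k R] (S : Subalgebra k R)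
    (Φ : R →ₐ[k] ((Fin m ⊕ Fin n → C) → k)) (hinj : Function.Injective Φ)
    (hS : ∀ f, f ∈ S ↔ Φ f ∈ D.superReg m n) (hrange : D.reg _ ≤ Φ.range) {X : Type*}
    (ev : X → S →ₐ[k] k) (hev : ∀ p, ∃ x, ∀ f, ev x f = Φ f.1 p) (I : Ideal S) (f : S)
    (h : ∀ x, (∀ g ∈ I, ev x g = 0) → ev x f = 0) : f ∈ I.radical := by
  let e := equivOfRealization S Φ hinj hS hrange
  have hmem : e f ∈ (I.map e).radical := by
    refine mem_radical_of_forall m n _ _ fun p hp => ?_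
    obtain ⟨x, hx⟩ := hev p
    exact (hx f).symm.trans (h x fun g hg => (hx g).trans (hp _ (Ideal.mem_map_of_mem e hg)))
  obtain ⟨N, hN⟩ := hmem
  refine ⟨N, ?_⟩
  rw [← map_pow] at hN
  obtain ⟨g, hg, hge⟩ := (Ideal.mem_map_iff_of_surjective e e.surjective).1 hN
  rwa [← e.injective hge]

theorem not_isNoetherianRing_of_realization [Infinite C] {R : Type*} [CommRing R]
    [Algebra k R] (S : Subalgebra k R)
    (Φ : R →ₐ[k] ((Fin m ⊕ Fin n → C) → k)) (hinj : Function.Injective Φ)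
    (hS : ∀ f, f ∈ S ↔ Φ f ∈ D.superReg m n) (hrange : D.reg _ ≤ Φ.range) (hm : 0 < m)
    (hn : 0 < n) : ¬ IsNoetherianRing S := by
  intro h
  obtain ⟨m, rfl⟩ := Nat.exists_eq_succ_of_ne_zero hm.ne'
  obtain ⟨n, rfl⟩ := Nat.exists_eq_succ_of_ne_zero hn.ne'
  exact not_isNoetherianRing_superReg m n
    (isNoetherianRing_of_ringEquiv S (equivOfRealization S Φ hinj hS hrange).toRingEquiv)

end CoordData

/-! ### The affine line and polynomials -/

theorem exists_polynomial_of_mem_adjoin_id {k : Type*} [Field k] {f : k → k}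
    (hf : f ∈ Algebra.adjoin k {(id : k → k)}) : ∃ P : Polynomial k, ∀ x, f x = P.eval x := by
  induction hf using Algebra.adjoin_induction with
  | mem f hf => exact ⟨Polynomial.X, fun x => by simp [Set.mem_singleton_iff.1 hf]⟩
  | algebraMap c => exact ⟨Polynomial.C c, fun x => by simp⟩
  | add f g _ _ hf hg =>
    obtain ⟨P, hP⟩ := hf
    obtain ⟨Q, hQ⟩ := hg
    exact ⟨P + Q, fun x => by simp [hP, hQ]⟩
  | mul f g _ _ hf hg =>
    obtain ⟨P, hP⟩ := hf
    obtain ⟨Q, hQ⟩ := hg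
    exact ⟨P * Q, fun x => by simp [hP, hQ]⟩

/-- The affine line. -/
def affineLine (k : Type*) [Field k] [Infinite k] : CoordData k k where
  z := id
  gens := {id}
  base := 0
  z_injective := Function.injective_id
  z_mem := rfl
  finite_gens := Set.finite_singleton _
  exists_point χ := ⟨χ ⟨id, Algebra.subset_adjoin rfl⟩, by
    intro φ h
    obtain rfl := Set.mem_singleton_iff.1 h
    rfl⟩
  divided_difference := by
    intro φ h
    obtain rfl := Set.mem_singleton_iff.1 h
    exact ⟨1, Subalgebra.one_mem _, 1, Subalgebra.one_mem _, by simp⟩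
  eq_zero_of_eq_zero_off f hf c h := by
    obtain ⟨P, hP⟩ := exists_polynomial_of_mem_adjoin_id hf
    have : P = 0 := Polynomial.eq_zero_of_infinite_isRoot P
      ((Set.finite_singleton c).infinite_compl.mono fun d hd => by
        simpa [Polynomial.IsRoot, ← hP] using h d hd)
    funext x
    simp [hP, this]

section Poly

variable {k : Type*} [Field k] {m n : ℕ}

/-- The signs by which the coordinates `y_j` are twisted. -/
def twist (k : Type*) [Field k] (m n : ℕ) : Fin m ⊕ Fin n → k :=
  Sum.elim 1 (-1)

@[simp] theorem twist_mul_twist_mul (v : Fin m ⊕ Fin n) (c : k) :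
    twist k m n v * (twist k m n v * c) = c := by
  rcases v with i | j <;> simp [twist]

/-- The realization of polynomials by functions, with the signs of the `y_j` changed. -/
def polyFun (k : Type*) [Field k] (m n : ℕ) :
    MvPolynomial (Fin m ⊕ Fin n) k →ₐ[k] ((Fin m ⊕ Fin n → k) → k) :=
  AlgHom.pi fun p => MvPolynomial.aeval (fun v => twist k m n v * p v)

theorem polyFun_apply (f : MvPolynomial (Fin m ⊕ Fin n) k) (p : Fin m ⊕ Fin n → k) :
    polyFun k m n f p = MvPolynomial.aeval (fun v => twist k m n v * p v) f := rfl

theorem polyFun_twist (f : MvPolynomial (Fin m ⊕ Fin n) k) (p : Fin m ⊕ Fin n → k) :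
    polyFun k m n f (fun v => twist k m n v * p v) = MvPolynomial.aeval p f := by
  rw [polyFun_apply]
  simp

theorem polyFun_injective [Infinite k] : Function.Injective (polyFun k m n) := fun f g h =>
  MvPolynomial.funext fun p => by
    rw [← MvPolynomial.coe_aeval_eq_eval]
    change MvPolynomial.aeval p f = MvPolynomial.aeval p g
    rw [← polyFun_twist, ← polyFun_twist, h]

theorem polyFun_X (v : Fin m ⊕ Fin n) :
    polyFun k m n (MvPolynomial.X v) = fun p => twist k m n v * p v := by
  funext p
  simp [polyFun_apply]

theorem polyFun_rename (σ : Equiv.Perm (Fin m)) (τ : Equiv.Perm (Fin n))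
    (f : MvPolynomial (Fin m ⊕ Fin n) k) (p : Fin m ⊕ Fin n → k) :
    polyFun k m n (MvPolynomial.rename (Equiv.sumCongr σ τ) f) p =
      polyFun k m n f (p ∘ Sum.map σ τ) := by
  rw [polyFun_apply, polyFun_apply, MvPolynomial.aeval_rename]
  congr 2
  funext v
  rcases v with i | j <;> simp [twist]

theorem aeval_substPoly (i : Fin m) (j : Fin n) (t : k) (f : MvPolynomial (Fin m ⊕ Fin n) k)
    (p : Fin m ⊕ Fin n → k) : MvPolynomial.aeval p (substPoly k m n i j t f) =
      MvPolynomial.aeval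
        (Function.update (Function.update p (Sum.inl i) t) (Sum.inr j) (-t)) f := by
  rw [substPoly, ← AlgHom.comp_apply, MvPolynomial.comp_aeval]
  congr 2
  funext v
  by_cases hj : v = Sum.inr j
  · subst hj; simp
  · by_cases hi : v = Sum.inl i
    · subst hi; simp
    · simp [hi, hj]

variable [Infinite k]

theorem polyFun_mem_reg (f : MvPolynomial (Fin m ⊕ Fin n) k) :
    polyFun k m n f ∈ (affineLine k).reg _ := by
  induction f using MvPolynomial.induction_on with
  | C a =>
    rw [← MvPolynomial.algebraMap_eq, AlgHom.commutes]
    exact Subalgebra.algebraMap_mem _ a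
  | add f g hf hg => rw [map_add]; exact Subalgebra.add_mem _ hf hg
  | mul_X f v hf =>
    rw [map_mul, polyFun_X]
    exact Subalgebra.mul_mem _ hf (Subalgebra.mul_mem _ (CoordData.const_mem_reg _)
      (CoordData.z_mem_reg (D := affineLine k) v))

theorem reg_le_range_polyFun : (affineLine k).reg (Fin m ⊕ Fin n) ≤ (polyFun k m n).range := by
  refine Algebra.adjoin_le ?_
  rintro _ ⟨φ, hφ, v, rfl⟩
  obtain rfl := Set.mem_singleton_iff.1 hφ
  refine ⟨MvPolynomial.C (twist k m n v) * MvPolynomial.X v, ?_⟩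
  funext p
  change polyFun k m n _ p = _
  simp [polyFun_apply]

/-- After the sign change of the `y_j`, the substitution `x_i = t`, `y_j = -t` parametrizes the
locus where the two coordinates agree. -/
theorem mem_superPoly_iff (f : MvPolynomial (Fin m ⊕ Fin n) k) :
    f ∈ superPoly k m n ↔ polyFun k m n f ∈ (affineLine k).superReg m n := by
  constructor
  · rintro ⟨h1, h2⟩
    refine ⟨polyFun_mem_reg f, fun σ τ p => by rw [← polyFun_rename, h1], ?_⟩
    intro i j p q hp hq hpq
    have key : ∀ r : Fin m ⊕ Fin n → k, r (Sum.inl i) = r (Sum.inr j) →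
        (∀ v, v ≠ Sum.inl i → v ≠ Sum.inr j → r v = q v) → polyFun k m n f r =
        MvPolynomial.aeval (fun v => twist k m n v * q v)
          (substPoly k m n i j (r (Sum.inl i)) f) := by
      intro r hr hrq
      rw [aeval_substPoly, polyFun_apply]
      congr 2
      funext v
      by_cases hj : v = Sum.inr j
      · subst hj; simp [twist, hr]
      · by_cases hi : v = Sum.inl i
        · subst hi; simp [twist]
        · simp [hi, hj, hrq]
    rw [key p hp hpq, key q hq fun _ _ _ => rfl, h2]
  · rintro ⟨-, h1, h2⟩
    refine ⟨fun σ τ => polyFun_injective (funext fun p => by rw [polyFun_rename, h1]), ?_⟩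
    intro i j s t
    refine polyFun_injective (funext fun p => ?_)
    rw [polyFun_apply, polyFun_apply, aeval_substPoly, aeval_substPoly, ← polyFun_twist,
      ← polyFun_twist]
    refine h2 i j _ _ (by simp [twist]) (by simp [twist]) fun v hi hj => ?_
    simp [hi, hj]

end Poly

/-! ### The punctured line and Laurent polynomials -/

section Laurent

variable {k : Type*} [Field k] {m n : ℕ}

theorem exists_polynomial_of_mem_adjoin_units {f : kˣ → k}
    (hf : f ∈ Algebra.adjoin k {((↑) : kˣ → k), fun u : kˣ => (↑u⁻¹ : k)}) :
    ∃ (N : ℕ) (P : Polynomial k), ∀ u : kˣ, (u : k) ^ N * f u = P.eval (u : k) := by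
  induction hf using Algebra.adjoin_induction with
  | mem f hf =>
    rcases hf with rfl | rfl
    · exact ⟨0, Polynomial.X, fun x => by simp⟩
    · exact ⟨1, 1, fun x => by simp⟩
  | algebraMap c => exact ⟨0, Polynomial.C c, fun x => by simp⟩
  | add f g _ _ hf hg =>
    obtain ⟨M, P, hP⟩ := hf
    obtain ⟨N, Q, hQ⟩ := hg
    refine ⟨M + N, Polynomial.X ^ N * P + Polynomial.X ^ M * Q, fun x => ?_⟩
    simp only [Pi.add_apply, Polynomial.eval_add, Polynomial.eval_mul, Polynomial.eval_pow,
      Polynomial.eval_X, ← hP, ← hQ]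
    ring
  | mul f g _ _ hf hg =>
    obtain ⟨M, P, hP⟩ := hf
    obtain ⟨N, Q, hQ⟩ := hg
    refine ⟨M + N, P * Q, fun x => ?_⟩
    simp only [Pi.mul_apply, Polynomial.eval_mul, ← hP, ← hQ]
    ring

theorem two_zpow_injective [CharZero k] : Function.Injective fun a : ℤ => (2 : k) ^ a := by
  intro a b h
  have h2 : (2 : ℚ) ^ a = 2 ^ b := by
    have : (((2 : ℚ) ^ a : ℚ) : k) = ((2 : ℚ) ^ b : ℚ) := by push_cast; exact h
    exact_mod_cast this
  exact zpow_right_injective₀ (by norm_num) (by norm_num) h2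

theorem zpow_units_injective [CharZero k] {a b : ℤ} (h : ∀ u : kˣ, (u : k) ^ a = (u : k) ^ b) :
    a = b :=
  two_zpow_injective (k := k) (h (Units.mk0 2 two_ne_zero))

instance infinite_units [CharZero k] : Infinite kˣ :=
  Infinite.of_injective (fun a : ℤ => (Units.mk0 (2 : k) two_ne_zero) ^ a) fun a b h =>
    two_zpow_injective (k := k) (by simpa using congrArg Units.val h)

/-- The punctured affine line. -/
def puncturedLine (k : Type*) [Field k] [CharZero k] : CoordData k kˣ where
  z := (↑)
  gens := {((↑) : kˣ → k), fun u : kˣ => (↑u⁻¹ : k)}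
  base := 1
  z_injective := Units.val_injective
  z_mem := Or.inl rfl
  finite_gens := Set.toFinite _
  exists_point χ := by
    have h : χ ⟨_, Algebra.subset_adjoin (Or.inl rfl)⟩ *
        χ ⟨_, Algebra.subset_adjoin (Or.inr rfl)⟩ = 1 := by
      rw [← map_mul, ← map_one χ]
      congr 1
      ext u
      simp
    refine ⟨Units.mkOfMulEqOne _ _ h, fun φ hφ => ?_⟩
    rcases hφ with rfl | rfl
    · rfl
    · rfl
  divided_difference := by
    rintro φ (rfl | rfl)
    · exact ⟨1, Subalgebra.one_mem _, 1, Subalgebra.one_mem _, by simp⟩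
    · refine ⟨_, Algebra.subset_adjoin (Or.inr rfl), _,
        Subalgebra.neg_mem _ (Algebra.subset_adjoin (Or.inr rfl)), fun s t => ?_⟩
      have hs := s.ne_zero
      have ht := t.ne_zero
      simp only [Units.val_inv_eq_inv_val, Pi.neg_apply]
      field_simp
      ring
  eq_zero_of_eq_zero_off f hf c h := by
    obtain ⟨N, P, hP⟩ := exists_polynomial_of_mem_adjoin_units hf
    have : P = 0 := Polynomial.eq_zero_of_infinite_isRoot P
      (((Set.finite_singleton c).infinite_compl.image Units.val_injective.injOn).mono (by
        rintro _ ⟨d, hd, rfl⟩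
        rw [Set.mem_ofPred_eq, Polynomial.IsRoot, ← hP, h d hd, mul_zero]))
    funext x
    simpa [this] using hP x

theorem evalTorus_single (p : Fin m ⊕ Fin n → kˣ) (a : (Fin m ⊕ Fin n) →₀ ℤ) (c : k) :
    evalTorus k m n p (AddMonoidAlgebra.single a c) = c * ∏ v, (p v : k) ^ a v := by
  rw [evalTorus, AddMonoidAlgebra.lift_single]
  rfl

theorem evalTorus_lvar (p : Fin m ⊕ Fin n → kˣ) (v : Fin m ⊕ Fin n) :
    evalTorus k m n p (lvar k v) = p v := by
  classical
  rw [lvar, evalTorus_single, one_mul, Finset.prod_eq_single v]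
  · simp
  · intro w _ hw
    simp [Finsupp.single_eq_of_ne hw]
  · simp

/-- The realization of Laurent polynomials by functions. -/
def laurentFun (k : Type*) [Field k] (m n : ℕ) :
    Laurent k m n →ₐ[k] ((Fin m ⊕ Fin n → kˣ) → k) :=
  AlgHom.pi fun p => evalTorus k m n p

theorem laurentFun_apply (f : Laurent k m n) (p : Fin m ⊕ Fin n → kˣ) :
    laurentFun k m n f p = evalTorus k m n p f := rfl

theorem evalTorus_domCongr (σ : Equiv.Perm (Fin m)) (τ : Equiv.Perm (Fin n))
    (f : Laurent k m n) (p : Fin m ⊕ Fin n → kˣ) :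
    evalTorus k m n p
      (AddMonoidAlgebra.domCongr k k (Finsupp.domCongr (Equiv.sumCongr σ τ)) f) =
      evalTorus k m n (p ∘ Sum.map σ τ) f := by
  induction f using AddMonoidAlgebra.induction_linear with
  | zero => simp
  | add f g hf hg => simp only [map_add, hf, hg]
  | single a c =>
    rw [AddMonoidAlgebra.domCongr_single, evalTorus_single, evalTorus_single]
    congr 1
    rw [← Equiv.prod_comp (Equiv.sumCongr σ τ)]
    refine Finset.prod_congr rfl fun v _ => ?_
    simp [Finsupp.domCongr, Finsupp.equivMapDomain_apply, Function.comp_apply]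

/-- Laurent monomials as characters of the torus. -/
def torusChar (k : Type*) [Field k] {ι : Type*} [Fintype ι] (a : ι →₀ ℤ) : (ι → kˣ) →* k where
  toFun p := ∏ v, (p v : k) ^ a v
  map_one' := by simp
  map_mul' p q := by simp [mul_zpow, Finset.prod_mul_distrib]

theorem torusChar_injective [CharZero k] {ι : Type*} [Fintype ι] :
    Function.Injective (torusChar k : (ι →₀ ℤ) → (ι → kˣ) →* k) := by
  classical
  intro a b h
  ext v
  refine zpow_units_injective (k := k) fun u => ?_
  have := DFunLike.congr_fun h (Function.update (1 : ι → kˣ) v u)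
  have key : ∀ a : ι →₀ ℤ, torusChar k a (Function.update (1 : ι → kˣ) v u) = (u : k) ^ a v := by
    intro a
    change ∏ w, _ = _
    rw [Finset.prod_eq_single v]
    · simp
    · intro w _ hw
      simp [hw]
    · simp
  rwa [key, key] at this

/-- Distinct monomials are distinct characters of the torus, hence linearly independent by Dedekind.
Powers of 2 separate the exponents in characteristic zero. -/
theorem laurentFun_injective [CharZero k] : Function.Injective (laurentFun k m n) := by
  rw [injective_iff_map_eq_zero]
  intro f hf
  have hli := (linearIndependent_monoidHom (Fin m ⊕ Fin n → kˣ) k).comp _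
    (torusChar_injective (k := k) (ι := Fin m ⊕ Fin n))
  have hlc : ∀ f : Laurent k m n, Finsupp.linearCombination k
      ((fun g : (Fin m ⊕ Fin n → kˣ) →* k => (g : (Fin m ⊕ Fin n → kˣ) → k)) ∘ torusChar k)
      f.coeff = laurentFun k m n f := by
    intro f
    induction f using AddMonoidAlgebra.induction_linear with
    | zero => simp
    | add f g hf hg => rw [AddMonoidAlgebra.coeff_add, map_add, hf, hg, map_add]
    | single a c =>
      funext p
      rw [laurentFun_apply, evalTorus_single, AddMonoidAlgebra.coeff_single]
      simp [torusChar]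
  have := linearIndependent_iff.1 hli f.coeff ((hlc f).trans hf)
  simpa using this

theorem finsupp_eq_zero_of_zpow_sum [CharZero k] (l : ℤ →₀ k)
    (h : ∀ t : kˣ, (l.sum fun d c => c * (t : k) ^ d) = 0) : l = 0 := by
  let χ : ℤ → kˣ →* k := fun d =>
    { toFun := fun t => (t : k) ^ d
      map_one' := by simp
      map_mul' := fun s t => by simp [mul_zpow] }
  have hχ : Function.Injective χ := fun a b hab =>
    zpow_units_injective (k := k) fun u => DFunLike.congr_fun hab u
  have hli := (linearIndependent_monoidHom kˣ k).comp _ hχ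
  refine linearIndependent_iff.1 hli l (funext fun t => ?_)
  simpa [Finsupp.linearCombination_apply, Finsupp.sum_apply', Finsupp.sum, χ] using h t

/-- The operator `x_i ∂/∂x_i + y_j ∂/∂y_j`. -/
def eulerPair (i : Fin m) (j : Fin n) (f : Laurent k m n) : Laurent k m n :=
  lvar k (Sum.inl i) * lpderiv k (Sum.inl i) f + lvar k (Sum.inr j) * lpderiv k (Sum.inr j) f

theorem eulerPair_add (i : Fin m) (j : Fin n) (f g : Laurent k m n) :
    eulerPair i j (f + g) = eulerPair i j f + eulerPair i j g := by
  simp only [eulerPair, map_add]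
  ring

theorem eulerPair_single (i : Fin m) (j : Fin n) (a : (Fin m ⊕ Fin n) →₀ ℤ) (c : k) :
    eulerPair i j (AddMonoidAlgebra.single a c) =
      AddMonoidAlgebra.single a (((a (Sum.inl i) + a (Sum.inr j) : ℤ) : k) * c) := by
  rw [eulerPair, lpderiv_single, lpderiv_single, lvar, lvar, AddMonoidAlgebra.single_mul_single,
    AddMonoidAlgebra.single_mul_single, add_sub_cancel, add_sub_cancel,
    ← AddMonoidAlgebra.single_add]
  congr 1
  push_cast
  ring

/-- The point with both coordinates `x_i` and `y_j` replaced by `t`. -/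
def diagPoint (i : Fin m) (j : Fin n) (q : Fin m ⊕ Fin n → kˣ) (t : kˣ) : Fin m ⊕ Fin n → kˣ :=
  Function.update (Function.update q (Sum.inl i) t) (Sum.inr j) t

theorem prod_diagPoint (i : Fin m) (j : Fin n) (q : Fin m ⊕ Fin n → kˣ) (t : kˣ)
    (a : (Fin m ⊕ Fin n) →₀ ℤ) :
    ∏ v, (diagPoint i j q t v : k) ^ a v =
      (∏ v, (diagPoint i j q 1 v : k) ^ a v) * (t : k) ^ (a (Sum.inl i) + a (Sum.inr j)) := by
  have h : ∀ v, (diagPoint i j q t v : k) ^ a v = (diagPoint i j q 1 v : k) ^ a v *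
      ((if v = Sum.inl i then (t : k) ^ a v else 1) *
        if v = Sum.inr j then (t : k) ^ a v else 1) := by
    intro v
    by_cases hj : v = Sum.inr j
    · subst hj; simp [diagPoint]
    · by_cases hi : v = Sum.inl i
      · subst hi; simp [diagPoint]
      · simp [diagPoint, hi, hj]
  simp only [h, Finset.prod_mul_distrib, Finset.prod_ite_eq', Finset.mem_univ, if_true]
  rw [zpow_add₀ t.ne_zero]

/-- The restriction of a Laurent polynomial to a curve of points `diagPoint i j q t` is a Laurent
polynomial in `t`, on which the operator `eulerPair` acts as the Euler operator. -/
theorem exists_diagPoint_expansion (i : Fin m) (j : Fin n) (q : Fin m ⊕ Fin n → kˣ)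
    (f : Laurent k m n) : ∃ l : ℤ →₀ k,
      (∀ t, evalTorus k m n (diagPoint i j q t) f = l.sum fun d c => c * (t : k) ^ d) ∧
      ∀ t, evalTorus k m n (diagPoint i j q t) (eulerPair i j f) =
        l.sum fun d c => (d : k) * c * (t : k) ^ d := by
  induction f using AddMonoidAlgebra.induction_linear with
  | zero => exact ⟨0, by simp, by simp [eulerPair]⟩
  | add f g hf hg =>
    obtain ⟨l, h1, h2⟩ := hf
    obtain ⟨l', h1', h2'⟩ := hg
    refine ⟨l + l', fun t => ?_, fun t => ?_⟩
    · rw [map_add, h1, h1', Finsupp.sum_add_index'] <;> intros <;> ring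
    · rw [eulerPair_add, map_add, h2, h2', Finsupp.sum_add_index'] <;> intros <;> ring
  | single a c =>
    refine ⟨Finsupp.single (a (Sum.inl i) + a (Sum.inr j))
      (c * ∏ v, (diagPoint i j q 1 v : k) ^ a v), fun t => ?_, fun t => ?_⟩
    · rw [evalTorus_single, prod_diagPoint, Finsupp.sum_single_index (by simp)]
      ring
    · rw [eulerPair_single, evalTorus_single, prod_diagPoint,
        Finsupp.sum_single_index (by simp)]
      ring

variable [CharZero k]

theorem zpow_val_mem_reg (v : Fin m ⊕ Fin n) (a : ℤ) :
    (fun p : Fin m ⊕ Fin n → kˣ => (p v : k) ^ a) ∈ (puncturedLine k).reg _ := by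
  rcases a with a | a
  · simp only [Int.ofNat_eq_natCast, zpow_natCast]
    exact Subalgebra.pow_mem _ (CoordData.z_mem_reg (D := puncturedLine k) v) a
  · have := Subalgebra.pow_mem _ (CoordData.gen_mem_reg (D := puncturedLine k)
      (φ := fun u : kˣ => (↑u⁻¹ : k)) (Or.inr rfl) v) (a + 1)
    convert this using 1
    funext p
    simp [zpow_negSucc]

theorem laurentFun_mem_reg (f : Laurent k m n) : laurentFun k m n f ∈ (puncturedLine k).reg _ := by
  induction f using AddMonoidAlgebra.induction_linear with
  | zero => rw [map_zero]; exact Subalgebra.zero_mem _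
  | add f g hf hg => rw [map_add]; exact Subalgebra.add_mem _ hf hg
  | single a c =>
    convert Subalgebra.mul_mem _ (CoordData.const_mem_reg (D := puncturedLine k) c)
      (Subalgebra.prod_mem _ (t := Finset.univ) fun v _ => zpow_val_mem_reg v (a v)) using 1
    funext p
    simp [laurentFun_apply, evalTorus_single]

theorem reg_le_range_laurentFun :
    (puncturedLine k).reg (Fin m ⊕ Fin n) ≤ (laurentFun k m n).range := by
  refine Algebra.adjoin_le ?_
  rintro _ ⟨φ, rfl | rfl, v, rfl⟩
  · exact ⟨lvar k v, funext fun p => evalTorus_lvar p v⟩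
  · refine ⟨AddMonoidAlgebra.single (Finsupp.single v (-1)) 1, funext fun p => ?_⟩
    classical
    change evalTorus k m n p _ = _
    rw [evalTorus_single, one_mul, Finset.prod_eq_single v]
    · simp
    · intro w _ hw
      simp [Finsupp.single_eq_of_ne hw]
    · simp

/-- A regular function vanishing where two coordinates agree is divisible by their difference, by
`exists_eq_sub_mul`. -/
theorem mem_span_sub_iff (i : Fin m) (j : Fin n) (f : Laurent k m n) :
    f ∈ Ideal.span {(lvar k (Sum.inl i) - lvar k (Sum.inr j) : Laurent k m n)} ↔
      ∀ p, p (Sum.inl i) = p (Sum.inr j) → evalTorus k m n p f = 0 := by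
  rw [Ideal.mem_span_singleton']
  constructor
  · rintro ⟨g, rfl⟩ p hp
    rw [map_mul, map_sub, evalTorus_lvar, evalTorus_lvar, hp, sub_self, mul_zero]
  · intro h
    obtain ⟨g, hg, hfg⟩ := CoordData.exists_eq_sub_mul (laurentFun_mem_reg f) h
    obtain ⟨g, rfl⟩ := reg_le_range_laurentFun hg
    refine ⟨g, laurentFun_injective (funext fun p => ?_)⟩
    rw [hfg p, laurentFun_apply, map_mul, map_sub, evalTorus_lvar, evalTorus_lvar, mul_comm]
    rfl

/-- On the curve, `f` is a Laurent polynomial in `t` and the operator multiplies the coefficient of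
`t ^ d` by `d`. In characteristic zero this kills exactly the constants. -/
theorem eulerPair_eq_zero_iff (i : Fin m) (j : Fin n) (f : Laurent k m n)
    (q : Fin m ⊕ Fin n → kˣ) :
    (∀ t, evalTorus k m n (diagPoint i j q t) (eulerPair i j f) = 0) ↔
      ∀ s t, evalTorus k m n (diagPoint i j q s) f = evalTorus k m n (diagPoint i j q t) f := by
  obtain ⟨l, h1, h2⟩ := exists_diagPoint_expansion i j q f
  simp only [h1, h2]
  constructor
  · intro h
    have hz := finsupp_eq_zero_of_zpow_sum
      (Finsupp.onFinset l.support (fun d => (d : k) * l d) fun d hd => by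
        rw [Finsupp.mem_support_iff]
        exact right_ne_zero_of_mul hd) fun t => by
      rw [Finsupp.onFinset_sum _ (by simp)]
      exact h t
    have hl : ∀ d, d ≠ 0 → l d = 0 := fun d hd => by
      have := DFunLike.congr_fun hz d
      simpa [hd] using this
    have hc : ∀ t : kˣ, (l.sum fun d c => c * (t : k) ^ d) = l 0 := fun t => by
      rw [Finsupp.sum, Finset.sum_eq_single 0]
      · simp
      · intro d _ hd
        rw [hl d hd, zero_mul]
      · intro h0
        simpa using h0
    intro s t
    rw [hc, hc]
  · intro h t
    -- Subtracting the value at `t = 1` from the constant coefficient leaves an identically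
    -- vanishing Laurent polynomial, so only the exponent 0 can occur in `l`.
    have hz := finsupp_eq_zero_of_zpow_sum
      (l - Finsupp.single 0 (l.sum fun d c => c * ((1 : kˣ) : k) ^ d)) fun t => by
      rw [Finsupp.sum_sub_index fun _ _ _ => sub_mul _ _ _, Finsupp.sum_single_index (by simp),
        h t 1]
      simp
    rw [sub_eq_zero] at hz
    rw [hz, Finsupp.sum_single_index (by simp)]
    simp

/-- Membership in the ideal of `x_i - y_j` is vanishing on `x_i = y_j`. That locus is swept out by
the curves `diagPoint i j q`, along which `eulerPair_eq_zero_iff` applies. -/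
theorem mem_superLaurent_iff (f : Laurent k m n) :
    f ∈ superLaurent k m n ↔ laurentFun k m n f ∈ (puncturedLine k).superReg m n := by
  have hdiag : ∀ (i : Fin m) (j : Fin n) (p q : Fin m ⊕ Fin n → kˣ),
      p (Sum.inl i) = p (Sum.inr j) → (∀ v, v ≠ Sum.inl i → v ≠ Sum.inr j → p v = q v) →
      p = diagPoint i j q (p (Sum.inl i)) := by
    intro i j p q hp hpq
    funext v
    by_cases hj : v = Sum.inr j
    · subst hj; simp [diagPoint, hp]
    · by_cases hi : v = Sum.inl i
      · subst hi; simp [diagPoint]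
      · simp [diagPoint, hi, hj, hpq]
  constructor
  · rintro ⟨h1, h2⟩
    refine ⟨laurentFun_mem_reg f, fun σ τ p => ?_, fun i j p q hp hq hpq => ?_⟩
    · rw [laurentFun_apply, laurentFun_apply, ← evalTorus_domCongr, h1]
    · refine (congrArg (laurentFun k m n f) (hdiag i j p q hp hpq)).trans (Eq.trans ?_
        (congrArg (laurentFun k m n f) (hdiag i j q q hq fun _ _ _ => rfl)).symm)
      rw [laurentFun_apply, laurentFun_apply]
      refine (eulerPair_eq_zero_iff i j f q).1 (fun t => ?_) _ _
      have h2' : eulerPair i j f ∈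
        Ideal.span {(lvar k (Sum.inl i) - lvar k (Sum.inr j) : Laurent k m n)} := h2 i j
      exact (mem_span_sub_iff i j _).1 h2' _ (by simp [diagPoint])
  · rintro ⟨-, h1, h2⟩
    refine ⟨fun σ τ => laurentFun_injective (funext fun p => ?_), fun i j => ?_⟩
    · rw [laurentFun_apply, evalTorus_domCongr]
      exact h1 σ τ p
    · refine (mem_span_sub_iff i j _).2 fun p hp => ?_
      rw [hdiag i j p p hp fun _ _ _ => rfl]
      refine (eulerPair_eq_zero_iff i j f p).2 (fun s t => ?_) _
      exact h2 i j _ _ (by simp [diagPoint]) (by simp [diagPoint]) fun v hi hj => by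
        simp [diagPoint, hi, hj]

end Laurent
end Supersym

end

theorem theorem6p2 (k : Type*) [Field k] [IsAlgClosed k] [CharZero k] (m n : ℕ) :
    -- Case S: supersymmetric polynomials
    ((Set.BijOn (Supersym.vanishing (Supersym.evalPoly k m n))
          {V | Supersym.IsSuperalgebraic (Supersym.evalPoly k m n) V}
          {I : Ideal (Supersym.superPoly k m n) | I.IsRadical} ∧
        Set.BijOn (fun I : Ideal (Supersym.superPoly k m n) =>
            Supersym.zeros (Supersym.evalPoly k m n) (I : Set (Supersym.superPoly k m n)))
          {I : Ideal (Supersym.superPoly k m n) | I.IsRadical}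
          {V | Supersym.IsSuperalgebraic (Supersym.evalPoly k m n) V} ∧
        Set.InvOn (fun I : Ideal (Supersym.superPoly k m n) =>
            Supersym.zeros (Supersym.evalPoly k m n) (I : Set (Supersym.superPoly k m n)))
          (Supersym.vanishing (Supersym.evalPoly k m n))
          {V | Supersym.IsSuperalgebraic (Supersym.evalPoly k m n) V}
          {I : Ideal (Supersym.superPoly k m n) | I.IsRadical} ∧
        Antitone (Supersym.vanishing (Supersym.evalPoly k m n)) ∧
        Antitone (fun I : Ideal (Supersym.superPoly k m n) =>
            Supersym.zeros (Supersym.evalPoly k m n) (I : Set (Supersym.superPoly k m n)))) ∧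
      (0 < m → 0 < n → ¬ IsNoetherianRing (Supersym.superPoly k m n))) ∧
    -- Case L: Laurent supersymmetric polynomials
    ((Set.BijOn (Supersym.vanishing (Supersym.evalLaurent k m n))
          {V | Supersym.IsSuperalgebraic (Supersym.evalLaurent k m n) V}
          {I : Ideal (Supersym.superLaurent k m n) | I.IsRadical} ∧
        Set.BijOn (fun I : Ideal (Supersym.superLaurent k m n) =>
            Supersym.zeros (Supersym.evalLaurent k m n) (I : Set (Supersym.superLaurent k m n)))
          {I : Ideal (Supersym.superLaurent k m n) | I.IsRadical}
          {V | Supersym.IsSuperalgebraic (Supersym.evalLaurent k m n) V} ∧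
        Set.InvOn (fun I : Ideal (Supersym.superLaurent k m n) =>
            Supersym.zeros (Supersym.evalLaurent k m n) (I : Set (Supersym.superLaurent k m n)))
          (Supersym.vanishing (Supersym.evalLaurent k m n))
          {V | Supersym.IsSuperalgebraic (Supersym.evalLaurent k m n) V}
          {I : Ideal (Supersym.superLaurent k m n) | I.IsRadical} ∧
        Antitone (Supersym.vanishing (Supersym.evalLaurent k m n)) ∧
        Antitone (fun I : Ideal (Supersym.superLaurent k m n) =>
            Supersym.zeros (Supersym.evalLaurent k m n) (I : Set (Supersym.superLaurent k m n)))) ∧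
      (0 < m → 0 < n → ¬ IsNoetherianRing (Supersym.superLaurent k m n))) := by
  open Supersym CoordData in
  refine ⟨⟨correspondence _ ?_, ?_⟩, correspondence _ ?_, ?_⟩
  · exact nullstellensatz_of_realization _ (polyFun k m n) polyFun_injective mem_superPoly_iff
      reg_le_range_polyFun _ fun p => ⟨fun v => twist k m n v * p v, fun f => rfl⟩
  · exact not_isNoetherianRing_of_realization _ (polyFun k m n) polyFun_injective
      mem_superPoly_iff reg_le_range_polyFun
  · exact nullstellensatz_of_realization _ (laurentFun k m n) laurentFun_injective
      mem_superLaurent_iff reg_le_range_laurentFun _ fun p => ⟨p, fun f => rfl⟩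
  · exact not_isNoetherianRing_of_realization _ (laurentFun k m n) laurentFun_injective
      mem_superLaurent_iff reg_le_range_laurentFun
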